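/- Let $q:\mathbf R\to\mathbf R$ and suppose that $e^{\rho|x|}q(x)\in W^{1,\infty}(\mathbf R;\mathbf R)$ for some $\rho>0$. Write $\hat q(k)=\frac1{2\pi}\int_{\mathbf R}e^{-ikx}q(x)\,dx$. For $\omega>0$, $\psi_0\in L^2(\mathbf R;\mathbf C)$ and $a_0\in\mathbf R$, a solution with initial data $(\psi_0,a_0)$ is a pair $(\psi,a)\in C^1(\mathbf R;L^2(\mathbf R;\mathbf C)\times\mathbf R)$ with $\psi(\cdot,0)=\psi_0$, $a(0)=a_0$ and, for all $t$, $$\psi_t=i\omega\psi+\omega a(t)q(x-t),\qquad \dot a(t)=-\frac1\omega\int_{\mathbf R}\operatorname{Re}[\psi(x,t)]\,q(x-t)\,dx .$$ There are $\omega_0>0$ and real numbers $\theta_\omega,r_\omega$ ($\omega\ge\omega_0$), depending only on $q$, $\rho$ and $\omega$, with $$\theta_\omega=2\pi^2|\hat q(\omega)|^2\,(1+O(1/\omega)),\qquad r_\omega=1+O(1/\omega)\qquad(\omega\to\infty),$$ such that for every $\omega\ge\omega_0$ the following hold. (1) For every $a_0\in\mathbf R$, the solution with initial data $(0,a_0)$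 satisfies $a(t)=a_0r_\omega e^{-\theta_\omega t}+b_\omega(t)$, where $\sup_{t\ge0}e^{\rho't}|b_\omega(t)|<\infty$ for every $\rho'<\rho/2$. (2) For every $\psi_0\in L^2(\mathbf R;\mathbf C)$ with $e^{\rho|x|}\psi_0(x)\in L^\infty(\mathbf R;\mathbf C)$ and every $a_0\in\mathbf R$ there is a constant $\alpha\in\mathbf R$ (depending on $\psi_0$ and $a_0$, as well as on $q$ and $\omega$, but not on $t$) such that the solution with initial data $(\psi_0,a_0)$ satisfies $a(t)=\alpha e^{-\theta_\omega t}+b_\omega(t)$, where $\sup_{t\ge0}e^{\rho't}|b_\omega(t)|<\infty$ for every $\rho'<\rho/2$. -/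

import Mathlib

open MeasureTheory Filter
open scoped ENNReal

/-- `g` is a weak derivative of `f` on the real line: integration by parts holds against every
smooth compactly supported test function. -/
def HasWeakDerivOnLine (f g : ℝ → ℝ) : Prop :=
  ∀ φ : ℝ → ℝ, ContDiff ℝ ((⊤ : ℕ∞) : WithTop ℕ∞) φ → HasCompactSupport φ →
    ∫ x, f x * deriv φ x = -∫ x, g x * φ x

/-- `f` belongs to the Sobolev space `W^{1,∞}(ℝ; ℝ)`: `f` is essentially bounded and has an
essentially bounded weak derivative. -/
def MemW1Infty (f : ℝ → ℝ) : Prop :=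
  MemLp f ∞ (volume : Measure ℝ) ∧
    ∃ g : ℝ → ℝ, MemLp g ∞ (volume : Measure ℝ) ∧ HasWeakDerivOnLine f g

/-- The Fourier transform with the normalization
`q̂(k) = (1 / 2π) ∫ exp(-i k x) q(x) dx`. -/
noncomputable def fourierHat (q : ℝ → ℝ) (k : ℝ) : ℂ :=
  (1 / (2 * (Real.pi : ℂ))) *
    ∫ x : ℝ, Complex.exp (-(Complex.I * (k : ℂ) * (x : ℂ))) * (q x : ℂ)

/-- The space `L²(ℝ; ℂ)`. -/
abbrev L2RC : Type := Lp ℂ 2 (volume : Measure ℝ)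

/-- `(ψ, a)` is a `C¹` solution, global in time and with values in `L²(ℝ; ℂ) × ℝ`, of
`ψ_t = i ω ψ + ω a(t) q(x - t)`,
`a' = -(1/ω) ∫ Re[ψ(x,t)] q(x - t) dx`,
with initial data `ψ(·, 0) = ψ₀` and `a(0) = a₀`.
The time derivative of `ψ` is taken in the norm of `L²(ℝ; ℂ)`. -/
structure IsSolution (q : ℝ → ℝ) (ω : ℝ) (ψ₀ : L2RC) (a₀ : ℝ)
    (ψ : ℝ → L2RC) (a : ℝ → ℝ) : Prop where
  contDiff_field : ContDiff ℝ 1 ψ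
  contDiff_amplitude : ContDiff ℝ 1 a
  field_eq : ∀ t : ℝ, ∀ᵐ x : ℝ,
    (deriv ψ t : L2RC) x
      = Complex.I * (ω : ℂ) * (ψ t : L2RC) x + (ω : ℂ) * (a t : ℂ) * (q (x - t) : ℂ)
  amplitude_eq : ∀ t : ℝ,
    deriv a t = -(1 / ω) * ∫ x : ℝ, ((ψ t : L2RC) x).re * q (x - t)
  field_init : ψ 0 = ψ₀
  amplitude_init : a 0 = a₀

/-- `sup_{t ≥ 0} exp(ρ' t) |b(t)| < ∞` for every `ρ' < ρ / 2`. -/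
def DecaysBelowHalf (ρ : ℝ) (b : ℝ → ℝ) : Prop :=
  ∀ ρ' : ℝ, ρ' < ρ / 2 → ∃ M : ℝ, ∀ t : ℝ, 0 ≤ t → Real.exp (ρ' * t) * |b t| ≤ M

/-! Pairing the field with a translate of `q` eliminates it (Duhamel,
`IsSolution.hasDerivAt_amplitude`). The amplitude then solves a' = f - K ∗ a on the half line, with
K(s) = cos(ωs) G(s), G the autocorrelation of `q`, and f a forcing term determined by the initial
field. Since `q` is localized and Lipschitz, G and its difference quotients decay at every rate
below ρ (`expLip_corr`); f decays likewise when the initial field does.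

For A(t) = exp(θt) a(t), integration gives A = a₀ + ∫ exp(θs) f + N ∗ A, where N(t) = θ - ∫₀ᵗ
exp(θs) K(s) ds (`volterra_integrated`). The rate θ is chosen so that N vanishes at infinity, i.e.
as a fixed point θ = Φ(θ) with Φ(θ) = ∫₀^∞ exp(θs) cos(ωs) G(s) ds. Then N(t) is a tail of an
oscillatory integral, and a Riemann-Lebesgue estimate that keeps the decay
(`abs_integral_cos_mul_le`) makes it O(1/ω) times a decaying exponential. For large ω the
convolution with N is a small perturbation, so A converges exponentially to a limit α with α (1 -
∫N) = a₀ + ∫ exp(θs) f (`volterra_asymptotics`). This gives the prefactor 1/(1 - ∫N) = 1 + O(1/ω).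

The size of θ comes from Φ(0), which equals 2π²|q̂(ω)|² by a Wiener-Khinchin computation
(`integral_Ioi_cos_mul_corr`), and from Φ(θ) - Φ(0) = θ · O(1/ω). The factor θ makes the error
relative, however small q̂(ω) may be. -/

/-! ### Exponentially decaying Lipschitz functions on the half line -/

/-- On the half line `[0, ∞)`, both `H` and its difference quotients over steps of length at most
one are bounded by `C exp(-lam s)`. -/
structure ExpLip (C lam : ℝ) (H : ℝ → ℝ) : Prop where
  bound : ∀ s, 0 ≤ s → |H s| ≤ C * Real.exp (-lam * s)
  lip : ∀ s, 0 ≤ s → ∀ h, 0 ≤ h → h ≤ 1 → |H (s + h) - H s| ≤ C * h * Real.exp (-lam * s)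

lemma ExpLip.nonneg {C lam : ℝ} {H : ℝ → ℝ} (hH : ExpLip C lam H) : 0 ≤ C := by
  have := (abs_nonneg _).trans (hH.bound 0 le_rfl)
  simpa using this

lemma ExpLip.weaken {C C' lam lam' : ℝ} {H : ℝ → ℝ} (hH : ExpLip C lam H) (hC : C ≤ C')
    (hl : lam' ≤ lam) : ExpLip C' lam' H := by
  have h0 := hH.nonneg
  have he : ∀ s, 0 ≤ s → Real.exp (-lam * s) ≤ Real.exp (-lam' * s) := fun s hs =>
    Real.exp_le_exp.2 (by nlinarith)
  have h0c := h0.trans hC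
  refine ⟨fun s hs => (hH.bound s hs).trans ?_, fun s hs h h0' h1 => (hH.lip s hs h h0' h1).trans ?_⟩
  · have := he s hs
    gcongr
  · have := he s hs
    gcongr

lemma ExpLip.mul {C₁ C₂ l₁ l₂ : ℝ} {H₁ H₂ : ℝ → ℝ} (h₁ : ExpLip C₁ l₁ H₁) (h₂ : ExpLip C₂ l₂ H₂) :
    ExpLip (C₁ * C₂ * (Real.exp |l₁| + 1)) (l₁ + l₂) (fun s => H₁ s * H₂ s) := by
  have c1 := h₁.nonneg
  have c2 := h₂.nonneg
  have hsplit : ∀ s, Real.exp (-(l₁ + l₂) * s) = Real.exp (-l₁ * s) * Real.exp (-l₂ * s) := by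
    intro s
    rw [← Real.exp_add]
    ring_nf
  have hone : 1 ≤ Real.exp |l₁| + 1 := by linarith [Real.exp_pos |l₁|]
  refine ⟨fun s hs => ?_, fun s hs h hh0 hh1 => ?_⟩
  · rw [abs_mul, hsplit]
    calc |H₁ s| * |H₂ s| ≤ (C₁ * Real.exp (-l₁ * s)) * (C₂ * Real.exp (-l₂ * s)) :=
          mul_le_mul (h₁.bound s hs) (h₂.bound s hs) (abs_nonneg _) (by positivity)
      _ = C₁ * C₂ * 1 * (Real.exp (-l₁ * s) * Real.exp (-l₂ * s)) := by ring
      _ ≤ _ := by gcongr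
  · have e1 : H₁ (s + h) * H₂ (s + h) - H₁ s * H₂ s
        = H₁ (s + h) * (H₂ (s + h) - H₂ s) + (H₁ (s + h) - H₁ s) * H₂ s := by ring
    have e2 : Real.exp (-l₁ * (s + h)) ≤ Real.exp |l₁| * Real.exp (-l₁ * s) := by
      rw [← Real.exp_add]
      refine Real.exp_le_exp.2 ?_
      have : -l₁ * h ≤ |l₁| := by
        calc -l₁ * h ≤ |l₁| * h := by gcongr; exact neg_le_abs l₁
          _ ≤ |l₁| * 1 := by gcongr
          _ = |l₁| := mul_one _
      linarith
    simp only [e1]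
    calc _ ≤ |H₁ (s + h)| * |H₂ (s + h) - H₂ s| + |H₁ (s + h) - H₁ s| * |H₂ s| := by
          rw [← abs_mul, ← abs_mul]; exact abs_add_le _ _
      _ ≤ (C₁ * (Real.exp |l₁| * Real.exp (-l₁ * s))) * (C₂ * h * Real.exp (-l₂ * s))
          + (C₁ * h * Real.exp (-l₁ * s)) * (C₂ * Real.exp (-l₂ * s)) := by
          have b1 := (h₁.bound (s + h) (by linarith)).trans
            (mul_le_mul_of_nonneg_left e2 c1)
          exact add_le_add
            (mul_le_mul b1 (h₂.lip s hs h hh0 hh1) (abs_nonneg _) (by positivity))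
            (mul_le_mul (h₁.lip s hs h hh0 hh1) (h₂.bound s hs) (abs_nonneg _) (by positivity))
      _ = _ := by rw [hsplit]; ring

lemma abs_exp_sub_exp_le (x y : ℝ) : |Real.exp x - Real.exp y| ≤ |x - y| * Real.exp (max x y) := by
  wlog h : y ≤ x generalizing x y
  · rw [abs_sub_comm, abs_sub_comm x, max_comm]
    exact this y x (le_of_not_ge h)
  rw [max_eq_left h, abs_of_nonneg (sub_nonneg.2 (Real.exp_le_exp.2 h)),
    abs_of_nonneg (sub_nonneg.2 h)]
  have h1 := Real.add_one_le_exp (y - x)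
  have h2 : Real.exp y = Real.exp x * Real.exp (y - x) := by rw [← Real.exp_add]; ring_nf
  rw [h2]
  nlinarith [Real.exp_pos x]

lemma abs_exp_mul_sub_le {θ η s h : ℝ} (hθ : |θ| ≤ η) (hs : 0 ≤ s) (hh0 : 0 ≤ h) (hh1 : h ≤ 1) :
    |Real.exp (θ * (s + h)) - Real.exp (θ * s)|
      ≤ |θ| * h * (Real.exp η * Real.exp (η * s)) := by
  refine (abs_exp_sub_exp_le _ _).trans ?_
  have h1 : |θ * (s + h) - θ * s| = |θ| * h := by
    rw [← mul_sub, abs_mul, add_sub_cancel_left, abs_of_nonneg hh0]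
  have hη : 0 ≤ η := (abs_nonneg _).trans hθ
  have h2 : θ ≤ η := (le_abs_self _).trans hθ
  rw [h1, ← Real.exp_add]
  gcongr
  refine max_le ?_ ?_ <;> nlinarith

/-- The negative rate -η allows growth, and the constant depends on η alone, so the estimate is
uniform over |θ| ≤ η. -/
lemma expLip_exp {θ η : ℝ} (hθ : |θ| ≤ η) :
    ExpLip (1 + η * Real.exp η) (-η) (fun s => Real.exp (θ * s)) := by
  have hη : 0 ≤ η := (abs_nonneg _).trans hθ
  have h2 : θ ≤ η := (le_abs_self _).trans hθ
  refine ⟨fun s hs => ?_, fun s hs h hh0 hh1 => ?_⟩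
  · rw [abs_of_pos (Real.exp_pos _), neg_neg]
    calc Real.exp (θ * s) ≤ 1 * Real.exp (η * s) := by
          rw [one_mul]; exact Real.exp_le_exp.2 (by gcongr)
      _ ≤ _ := by gcongr; linarith [mul_nonneg hη (Real.exp_pos η).le]
  · refine (abs_exp_mul_sub_le hθ hs hh0 hh1).trans ?_
    rw [neg_neg]
    calc |θ| * h * (Real.exp η * Real.exp (η * s))
        ≤ η * h * (Real.exp η * Real.exp (η * s)) := by gcongr
      _ = (0 + η * Real.exp η) * h * Real.exp (η * s) := by ring
      _ ≤ _ := by gcongr; norm_num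

/-- The mean value bound costs a factor s, absorbed by s ≤ exp(ηs)/η; hence the growth rate 2η.
Dividing by θ with constants independent of θ is what later yields a relative error for the rate. -/
lemma expLip_exp_sub_one_div {θ η : ℝ} (hθ : |θ| ≤ η) (hη : 0 < η) (hη1 : θ ≠ 0) :
    ExpLip (1 / η + Real.exp η) (-(2 * η)) (fun s => (Real.exp (θ * s) - 1) / θ) := by
  have h2 : θ ≤ η := (le_abs_self _).trans hθ
  have hp : 0 < |θ| := abs_pos.2 hη1
  refine ⟨fun s hs => ?_, fun s hs h hh0 hh1 => ?_⟩
  · rw [abs_div, div_le_iff₀ hp, neg_neg]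
    have h3 := abs_exp_sub_exp_le (θ * s) 0
    rw [Real.exp_zero, sub_zero, abs_mul, abs_of_nonneg hs] at h3
    have h4 : Real.exp (max (θ * s) 0) ≤ Real.exp (η * s) :=
      Real.exp_le_exp.2 (max_le (by gcongr) (by positivity))
    have h5 : s ≤ 1 / η * Real.exp (η * s) := by
      rw [div_mul_eq_mul_div, one_mul, le_div_iff₀ hη]
      linarith [Real.add_one_le_exp (η * s)]
    have h6 : Real.exp (2 * η * s) = Real.exp (η * s) * Real.exp (η * s) := by
      rw [← Real.exp_add]; ring_nf
    calc _ ≤ |θ| * s * Real.exp (max (θ * s) 0) := h3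
      _ ≤ |θ| * (1 / η * Real.exp (η * s)) * Real.exp (η * s) := by gcongr
      _ = (1 / η + 0) * Real.exp (2 * η * s) * |θ| := by rw [h6]; ring
      _ ≤ _ := by gcongr; positivity
  · rw [← sub_div, abs_div, div_le_iff₀ hp, neg_neg, sub_sub_sub_cancel_right]
    refine (abs_exp_mul_sub_le hθ hs hh0 hh1).trans ?_
    have h6 : Real.exp (η * s) ≤ Real.exp (2 * η * s) := Real.exp_le_exp.2 (by nlinarith)
    calc |θ| * h * (Real.exp η * Real.exp (η * s))
        ≤ |θ| * h * (Real.exp η * Real.exp (2 * η * s)) := by gcongr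
      _ = (0 + Real.exp η) * h * Real.exp (2 * η * s) * |θ| := by ring
      _ ≤ _ := by gcongr; positivity

/-! ### Tail integrals -/

lemma integrableOn_exp_neg_mul_Ioi {lam : ℝ} (hl : 0 < lam) (C t : ℝ) :
    IntegrableOn (fun s => C * Real.exp (-lam * s)) (Set.Ioi t) :=
  (integrableOn_exp_mul_Ioi (by linarith) t).const_mul C

lemma integral_exp_neg_mul_Ioi {lam : ℝ} (hl : 0 < lam) (C t : ℝ) :
    ∫ s in Set.Ioi t, C * Real.exp (-lam * s) = C / lam * Real.exp (-lam * t) := by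
  rw [integral_const_mul, integral_exp_mul_Ioi (by linarith)]
  field_simp

lemma abs_integral_Ioi_le {f : ℝ → ℝ} {C lam t : ℝ} (hl : 0 < lam)
    (hf : ∀ s, t < s → |f s| ≤ C * Real.exp (-lam * s)) :
    |∫ s in Set.Ioi t, f s| ≤ C / lam * Real.exp (-lam * t) := by
  rw [← integral_exp_neg_mul_Ioi hl, ← Real.norm_eq_abs]
  refine norm_integral_le_of_norm_le (integrableOn_exp_neg_mul_Ioi hl C t) ?_
  exact (ae_restrict_iff' measurableSet_Ioi).2 (Eventually.of_forall fun s hs => hf s hs)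

lemma integrableOn_Ioi_of_abs_le {f : ℝ → ℝ} {C lam t : ℝ} (hl : 0 < lam) (hc : Continuous f)
    (hf : ∀ s, t < s → |f s| ≤ C * Real.exp (-lam * s)) : IntegrableOn f (Set.Ioi t) := by
  refine (integrableOn_exp_neg_mul_Ioi hl C t).mono' hc.aestronglyMeasurable ?_
  exact (ae_restrict_iff' measurableSet_Ioi).2 (Eventually.of_forall fun s hs => hf s hs)

lemma integral_Ioi_add_right (f : ℝ → ℝ) (t h : ℝ) :
    ∫ s in Set.Ioi t, f (s + h) = ∫ s in Set.Ioi (t + h), f s := by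
  have := (measurePreserving_add_right (volume : Measure ℝ) h).setIntegral_preimage_emb
    (measurableEmbedding_addRight h) f (Set.Ioi (t + h))
  rw [← this]
  simp

/-- The Riemann-Lebesgue estimate for exponentially decaying Lipschitz functions, with the decay
retained. -/
lemma abs_integral_cos_mul_le {H : ℝ → ℝ} {C lam ω t : ℝ} (hc : Continuous H)
    (hH : ExpLip C lam H) (hl : 0 < lam) (hω : Real.pi ≤ ω) (ht : 0 ≤ t) :
    |∫ s in Set.Ioi t, Real.cos (ω * s) * H s|
      ≤ (Real.pi / 2 * (1 + 1 / lam)) * C / ω * Real.exp (-lam * t) := by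
  have hω0 : 0 < ω := Real.pi_pos.trans_le hω
  set h : ℝ := Real.pi / ω with hh
  have hh0 : 0 ≤ h := by positivity
  have hh1 : h ≤ 1 := by rw [hh, div_le_one hω0]; exact hω
  have hC := hH.nonneg
  have hb : ∀ s, 0 ≤ s → |Real.cos (ω * s) * H s| ≤ C * Real.exp (-lam * s) := by
    intro s hs
    rw [abs_mul]
    calc _ ≤ 1 * |H s| := by gcongr; exact Real.abs_cos_le_one _
      _ ≤ _ := by rw [one_mul]; exact hH.bound s hs
  have hcc : Continuous fun s => Real.cos (ω * s) * H s := by fun_prop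
  have hi : IntegrableOn (fun s => Real.cos (ω * s) * H s) (Set.Ioi t) :=
    integrableOn_Ioi_of_abs_le hl hcc fun s hs => hb s (by linarith)
  have hsplit := intervalIntegral.integral_Ioi_sub_Ioi hi (by linarith : t ≤ t + h)
  have hshift : ∫ s in Set.Ioi (t + h), Real.cos (ω * s) * H s
      = - ∫ s in Set.Ioi t, Real.cos (ω * s) * H (s + h) := by
    rw [← integral_Ioi_add_right, ← integral_neg]
    congr 1
    ext s
    have : ω * (s + h) = ω * s + Real.pi := by rw [hh]; field_simp
    rw [this, Real.cos_add_pi]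
    ring
  have hi2 : IntegrableOn (fun s => Real.cos (ω * s) * H (s + h)) (Set.Ioi t) := by
    refine integrableOn_Ioi_of_abs_le (C := C) hl (by fun_prop) fun s hs => ?_
    rw [abs_mul]
    have h1 := hH.bound (s + h) (by linarith)
    have h2 : Real.exp (-lam * (s + h)) ≤ Real.exp (-lam * s) :=
      Real.exp_le_exp.2 (by nlinarith)
    calc _ ≤ 1 * |H (s + h)| := by gcongr; exact Real.abs_cos_le_one _
      _ ≤ C * Real.exp (-lam * s) := by
        rw [one_mul]; exact h1.trans (by gcongr)
  have hdiff : ∫ s in Set.Ioi t, Real.cos (ω * s) * (H s - H (s + h))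
      = (∫ s in Set.Ioi t, Real.cos (ω * s) * H s)
        - ∫ s in Set.Ioi t, Real.cos (ω * s) * H (s + h) := by
    rw [← integral_sub hi hi2]
    congr 1
    ext s
    ring
  -- Shifting by the half period h = π/ω reverses the sign of the cosine. Averaging the integral
  -- with its shifted form leaves an interval of length h and an increment of `H` over h, both
  -- O(1/ω).
  have hkey : 2 * ∫ s in Set.Ioi t, Real.cos (ω * s) * H s
      = (∫ s in t..(t + h), Real.cos (ω * s) * H s)
        + ∫ s in Set.Ioi t, Real.cos (ω * s) * (H s - H (s + h)) := by
    rw [hdiff, ← hsplit, hshift]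
    ring
  have b1 : |∫ s in t..(t + h), Real.cos (ω * s) * H s| ≤ C * Real.exp (-lam * t) * h := by
    have := intervalIntegral.norm_integral_le_of_norm_le_const (a := t) (b := t + h)
      (f := fun s => Real.cos (ω * s) * H s) (C := C * Real.exp (-lam * t)) ?_
    · rwa [Real.norm_eq_abs, add_sub_cancel_left, abs_of_nonneg hh0] at this
    · intro s hs
      rw [Set.uIoc_of_le (by linarith)] at hs
      refine (hb s (by linarith [hs.1])).trans ?_
      have : Real.exp (-lam * s) ≤ Real.exp (-lam * t) :=
        Real.exp_le_exp.2 (by nlinarith [hs.1])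
      gcongr
  have b2 : |∫ s in Set.Ioi t, Real.cos (ω * s) * (H s - H (s + h))|
      ≤ C * h / lam * Real.exp (-lam * t) := by
    refine abs_integral_Ioi_le hl fun s hs => ?_
    rw [abs_mul, abs_sub_comm]
    calc _ ≤ 1 * |H (s + h) - H s| := by gcongr; exact Real.abs_cos_le_one _
      _ ≤ _ := by rw [one_mul]; exact hH.lip s (by linarith) h hh0 hh1
  have b3 : 2 * |∫ s in Set.Ioi t, Real.cos (ω * s) * H s|
      ≤ C * Real.exp (-lam * t) * h + C * h / lam * Real.exp (-lam * t) := by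
    have h2 (x : ℝ) : 2 * |x| = |2 * x| := by rw [abs_mul, abs_two]
    rw [h2, hkey]
    exact (abs_add_le _ _).trans (add_le_add b1 b2)
  have b4 : (Real.pi / 2 * (1 + 1 / lam)) * C / ω * Real.exp (-lam * t)
      = (C * Real.exp (-lam * t) * h + C * h / lam * Real.exp (-lam * t)) / 2 := by
    rw [hh]; field_simp
  rw [b4]
  linarith

/-! ### Essentially bounded functions with an essentially bounded weak derivative -/

lemma exists_ae_norm_le {α E : Type*} [MeasurableSpace α] [NormedAddCommGroup E] {μ : Measure α}
    {f : α → E} (hf : MemLp f ∞ μ) : ∃ B : ℝ, 0 ≤ B ∧ ∀ᵐ x ∂μ, ‖f x‖ ≤ B := by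
  have hfin : eLpNormEssSup f μ ≠ ∞ := by
    rw [← eLpNorm_exponent_top]
    exact hf.2.ne
  refine ⟨(eLpNormEssSup f μ).toReal, ENNReal.toReal_nonneg, ?_⟩
  filter_upwards [ae_le_eLpNormEssSup (f := f) (μ := μ)] with x hx
  rw [← toReal_enorm]
  exact ENNReal.toReal_mono hfin hx

/-- An essentially bounded real function has a measurable representative bounded everywhere. -/
lemma exists_measurable_bounded_rep {f : ℝ → ℝ} (hf : MemLp f ∞ volume) :
    ∃ (B : ℝ) (g : ℝ → ℝ), 0 ≤ B ∧ Measurable g ∧ (∀ x, |g x| ≤ B) ∧ f =ᵐ[volume] g := by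
  obtain ⟨B, hB, hb⟩ := exists_ae_norm_le hf
  have hm := hf.1.stronglyMeasurable_mk.measurable
  refine ⟨B, fun x => max (-B) (min (hf.1.mk f x) B), hB, by fun_prop, fun x => ?_, ?_⟩
  · rw [abs_le]
    exact ⟨le_max_left _ _, max_le (by linarith) (min_le_right _ _)⟩
  · filter_upwards [hf.1.ae_eq_mk, hb] with x hx hbx
    rw [Real.norm_eq_abs, abs_le] at hbx
    rw [← hx, min_eq_left hbx.2, max_eq_right hbx.1]

lemma ae_comp_add_right {P : ℝ → Prop} (h : ∀ᵐ x : ℝ, P x) (c : ℝ) : ∀ᵐ x : ℝ, P (x + c) :=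
  (measurePreserving_add_right (volume : Measure ℝ) c).quasiMeasurePreserving.ae h

lemma ae_comp_sub_right {P : ℝ → Prop} (h : ∀ᵐ x : ℝ, P x) (c : ℝ) : ∀ᵐ x : ℝ, P (x - c) := by
  simpa only [sub_eq_add_neg] using ae_comp_add_right h (-c)

lemma integrable_mul_comp_sub {p φ : ℝ → ℝ} {B : ℝ} (hp : Measurable p) (hb : ∀ x, |p x| ≤ B)
    (hφ : Integrable φ) (h : ℝ) :
    Integrable (Function.uncurry fun s x : ℝ => p x * φ (x - s))
      ((volume.restrict (Set.uIoc 0 h)).prod volume) := by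
  have h1 : Integrable (fun z : ℝ × ℝ => φ (z.1 - z.2))
      ((volume : Measure ℝ).prod (volume.restrict (Set.uIoc 0 h))) := by
    have := Integrable.convolution_integrand (ContinuousLinearMap.mul ℝ ℝ)
      (f := fun _ => (1 : ℝ)) (ν := volume.restrict (Set.uIoc 0 h)) (by
        refine integrable_const_iff.2 (Or.inr ?_)
        exact ⟨by simp [Set.uIoc]⟩) hφ
    simpa using this
  exact h1.swap.bdd_mul (f := fun z : ℝ × ℝ => p z.2)
    (hp.comp measurable_snd).aestronglyMeasurable (ae_of_all _ fun z => hb z.2)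

lemma integrable_mul_comp_add {g φ : ℝ → ℝ} {B : ℝ} (hg : Measurable g) (hb : ∀ x, |g x| ≤ B)
    (hφ : Integrable φ) (h : ℝ) :
    Integrable (Function.uncurry fun s x : ℝ => g (x + s) * φ x)
      ((volume.restrict (Set.uIoc 0 h)).prod volume) := by
  have h1 : Integrable (fun z : ℝ × ℝ => (1 : ℝ) * φ z.2)
      ((volume.restrict (Set.uIoc 0 h)).prod (volume : Measure ℝ)) := by
    refine Integrable.mul_prod (f := fun _ => (1 : ℝ)) ?_ hφ
    exact integrable_const_iff.2 (Or.inr ⟨by simp [Set.uIoc]⟩)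
  simp only [one_mul] at h1
  exact h1.bdd_mul (f := fun z : ℝ × ℝ => g (z.2 + z.1))
    (hg.comp (measurable_snd.add measurable_fst)).aestronglyMeasurable
    (ae_of_all _ fun z => hb _)

/-- Tested against φ, the translation moves onto φ, and φ(x - h) - φ(x) is an integral of -φ'(x - s)
over s. Fubini and the weak derivative on each slice s, followed by translating back, give equality
against every test function. -/
lemma HasWeakDerivOnLine.sub_eq_integral {p g : ℝ → ℝ} {B B' : ℝ} (hp : Measurable p)
    (hpb : ∀ x, |p x| ≤ B) (hg : Measurable g) (hgb : ∀ x, |g x| ≤ B')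
    (hw : HasWeakDerivOnLine p g) (h : ℝ) :
    ∀ᵐ x : ℝ, p (x + h) - p x = ∫ s in (0 : ℝ)..h, g (x + s) := by
  have hgi : ∀ a b : ℝ, IntervalIntegrable g volume a b := fun a b => by
    rw [intervalIntegrable_iff]
    exact Measure.integrableOn_of_bounded (M := B') (by simp [Set.uIoc])
      hg.aestronglyMeasurable (ae_of_all _ hgb)
  have hE : (fun x => ∫ s in (0 : ℝ)..h, g (x + s))
      = fun x => (∫ s in (0 : ℝ)..(x + h), g s) - ∫ s in (0 : ℝ)..x, g s := by
    ext x
    rw [intervalIntegral.integral_comp_add_left, add_zero,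
      intervalIntegral.integral_interval_sub_left (hgi _ _) (hgi _ _)]
  have hprim : Continuous fun x => ∫ s in (0 : ℝ)..x, g s :=
    intervalIntegral.continuous_primitive hgi 0
  have hloc : ∀ f : ℝ → ℝ, Measurable f → (∃ C, ∀ x, |f x| ≤ C) → LocallyIntegrable f volume :=
    fun f hf ⟨C, hC⟩ => (locallyIntegrable_const C).mono hf.aestronglyMeasurable
      (ae_of_all _ fun x => (hC x).trans (le_abs_self C))
  refine ae_eq_of_integral_contDiff_smul_eq (hloc _ (by fun_prop) ⟨B + B, fun x =>
    (abs_sub _ _).trans (add_le_add (hpb _) (hpb _))⟩) ?_ fun φ hφ hφc => ?_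
  · rw [hE]
    exact ((hprim.comp (continuous_add_const h)).sub hprim).locallyIntegrable
  have hφd : Continuous (deriv φ) := hφ.continuous_deriv (by simp)
  have hφi : Integrable φ := hφ.continuous.integrable_of_hasCompactSupport hφc
  have hφ'i : Integrable (deriv φ) := hφd.integrable_of_hasCompactSupport hφc.deriv
  have hmul : ∀ ψ : ℝ → ℝ, Integrable ψ → Integrable fun x => p x * ψ x := fun ψ hψ =>
    hψ.bdd_mul hp.aestronglyMeasurable (ae_of_all _ hpb)
  have hslice : ∀ s : ℝ, ∫ x, p x * deriv φ (x - s) = -∫ x, g (x + s) * φ x := fun s => by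
    have h1 := hw (fun x => φ (x - s)) (hφ.comp (contDiff_id.sub contDiff_const))
      (hφc.comp_homeomorph (Homeomorph.subRight s))
    simp only [deriv_comp_sub_const] at h1
    rw [h1, ← integral_add_right_eq_self (fun x => g x * φ (x - s)) s]
    simp
  calc ∫ x, φ x • (p (x + h) - p x)
      = ∫ x, (p (x + h) * φ x - p x * φ x) := by congr 1; ext x; simp; ring
    _ = (∫ x, p (x + h) * φ x) - ∫ x, p x * φ x := by
        refine integral_sub ?_ (hmul φ hφi)
        exact hφi.bdd_mul (hp.comp (measurable_add_const h)).aestronglyMeasurable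
          (ae_of_all _ fun x => hpb _)
    _ = (∫ x, p x * φ (x - h)) - ∫ x, p x * φ x := by
        rw [← integral_add_right_eq_self (fun x => p x * φ (x - h)) h]
        simp
    _ = ∫ x, p x * (φ (x - h) - φ x) := by
        rw [← integral_sub (hmul _ (hφi.comp_sub_right h)) (hmul _ hφi)]
        simp only [mul_sub]
    _ = ∫ x, -∫ s in (0 : ℝ)..h, p x * deriv φ (x - s) := by
        congr 1
        ext x
        rw [intervalIntegral.integral_const_mul, intervalIntegral.integral_comp_sub_left,
          intervalIntegral.integral_deriv_eq_sub
            (fun y _ => (hφ.differentiable (by simp)).differentiableAt)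
            (hφd.intervalIntegrable _ _), sub_zero]
        ring
    _ = -∫ s in (0 : ℝ)..h, ∫ x, p x * deriv φ (x - s) := by
        rw [integral_neg, intervalIntegral_integral_swap (integrable_mul_comp_sub hp hpb hφ'i h)]
    _ = ∫ s in (0 : ℝ)..h, ∫ x, g (x + s) * φ x := by
        simp only [hslice, intervalIntegral.integral_neg, neg_neg]
    _ = ∫ x, φ x • ∫ s in (0 : ℝ)..h, g (x + s) := by
        rw [intervalIntegral_integral_swap (integrable_mul_comp_add hg hgb hφi h)]
        simp only [intervalIntegral.integral_mul_const, smul_eq_mul, mul_comm (φ _)]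

/-- The exceptional null set may depend on `h`. This suffices, since increments are only ever
integrated in x for a fixed step. -/
lemma MemW1Infty.ae_bounds {p : ℝ → ℝ} (hp : MemW1Infty p) :
    ∃ B : ℝ, 0 ≤ B ∧ (∀ᵐ x : ℝ, |p x| ≤ B) ∧
      ∀ h : ℝ, ∀ᵐ x : ℝ, |p (x + h) - p x| ≤ B * |h| := by
  obtain ⟨hp0, g, hg, hw⟩ := hp
  obtain ⟨B, p', hB, hp'm, hp'b, hpp'⟩ := exists_measurable_bounded_rep hp0
  obtain ⟨B', g', hB', hg'm, hg'b, hgg'⟩ := exists_measurable_bounded_rep hg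
  have hw' : HasWeakDerivOnLine p' g' := fun φ h1 h2 => by
    have e1 : ∫ x, p' x * deriv φ x = ∫ x, p x * deriv φ x :=
      integral_congr_ae (by filter_upwards [hpp'] with x hx; rw [hx])
    have e2 : ∫ x, g' x * φ x = ∫ x, g x * φ x :=
      integral_congr_ae (by filter_upwards [hgg'] with x hx; rw [hx])
    rw [e1, e2]
    exact hw φ h1 h2
  refine ⟨max B B', hB.trans (le_max_left _ _), ?_, fun h => ?_⟩
  · filter_upwards [hpp'] with x hx
    rw [hx]
    exact (hp'b x).trans (le_max_left _ _)
  · filter_upwards [hpp', ae_comp_add_right hpp' h, hw'.sub_eq_integral hp'm hp'b hg'm hg'b h]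
      with x h1 h2 h3
    rw [h1, h2, h3]
    have := intervalIntegral.norm_integral_le_of_norm_le_const (a := 0) (b := h)
      (f := fun s => g' (x + s)) (C := B') fun s _ => hg'b _
    rw [sub_zero, Real.norm_eq_abs] at this
    exact this.trans (by gcongr; exact le_max_right _ _)

/-! ### Exponentially localized Lipschitz profiles -/

/-- `q` and its difference quotients over steps of length at most one are bounded by
`C exp(-ρ|x|)` almost everywhere. -/
structure Localized (C ρ : ℝ) (q : ℝ → ℝ) : Prop where
  meas : AEStronglyMeasurable q volume
  bound : ∀ᵐ x : ℝ, |q x| ≤ C * Real.exp (-ρ * |x|)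
  lip : ∀ h : ℝ, |h| ≤ 1 → ∀ᵐ x : ℝ, |q (x + h) - q x| ≤ C * |h| * Real.exp (-ρ * |x|)

lemma exists_localized {q : ℝ → ℝ} {ρ : ℝ} (hρ : 0 < ρ)
    (hq : MemW1Infty (fun x : ℝ => Real.exp (ρ * |x|) * q x)) :
    ∃ C : ℝ, 0 ≤ C ∧ Localized C ρ q := by
  obtain ⟨B, hB, hb, hl⟩ := hq.ae_bounds
  have hqp : ∀ x, q x = Real.exp (-ρ * |x|) * (Real.exp (ρ * |x|) * q x) := fun x => by
    rw [← mul_assoc, ← Real.exp_add]; simp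
  have hbq : ∀ᵐ x : ℝ, |q x| ≤ B * Real.exp (-ρ * |x|) := by
    filter_upwards [hb] with x hx
    rw [hqp x, abs_mul, abs_of_pos (Real.exp_pos _), mul_comm]
    gcongr
  have hexp1 : ∀ x h : ℝ, |h| ≤ 1 → -ρ * |x + h| ≤ ρ + -ρ * |x| := fun x h hh => by
    have h2 : |x| ≤ |x + h| + |h| := by
      have := abs_sub (x + h) h
      rwa [add_sub_cancel_right] at this
    nlinarith
  have hexp : ∀ x h : ℝ, |h| ≤ 1 → Real.exp (-ρ * |x + h|) ≤ Real.exp ρ * Real.exp (-ρ * |x|) :=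
    fun x h hh => by
      rw [← Real.exp_add]
      exact Real.exp_le_exp.2 (hexp1 x h hh)
  -- Discrete product rule for exp(-ρ|x|) times the bounded Lipschitz factor: exp ρ pays for moving
  -- the weight from x + h to x, and 1 + ρ collects the two increments. The last summand 1 covers
  -- the pointwise bound.
  refine ⟨B * (Real.exp ρ * (1 + ρ) + 1), by positivity, ?_, ?_, fun h hh => ?_⟩
  · have h1 : AEStronglyMeasurable (fun x : ℝ => Real.exp (-ρ * |x|) * (Real.exp (ρ * |x|) * q x))
        volume :=
      AEStronglyMeasurable.mul (by fun_prop : Continuous fun x : ℝ =>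
        Real.exp (-ρ * |x|)).aestronglyMeasurable hq.1.1
    exact h1.congr (ae_of_all _ fun x => (hqp x).symm)
  · filter_upwards [hbq] with x hx
    refine hx.trans ?_
    have : 1 ≤ Real.exp ρ * (1 + ρ) + 1 := by linarith [show 0 ≤ Real.exp ρ * (1 + ρ) by positivity]
    gcongr
    exact le_mul_of_one_le_right hB this
  · filter_upwards [hb, hl h] with x hx hxl
    set P := fun x => Real.exp (ρ * |x|) * q x with hP
    have e : q (x + h) - q x = Real.exp (-ρ * |x + h|) * (P (x + h) - P x)
        + (Real.exp (-ρ * |x + h|) - Real.exp (-ρ * |x|)) * P x := by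
      rw [hqp (x + h), hqp x, hP]
      ring
    have h3 : |Real.exp (-ρ * |x + h|) - Real.exp (-ρ * |x|)|
        ≤ ρ * |h| * (Real.exp ρ * Real.exp (-ρ * |x|)) := by
      refine (abs_exp_sub_exp_le _ _).trans ?_
      have h4 : abs (-ρ * |x + h| - -ρ * |x|) ≤ ρ * |h| := by
        rw [← mul_sub, abs_mul, abs_neg, abs_of_pos hρ]
        have h5 := abs_abs_sub_abs_le_abs_sub (x + h) x
        rw [add_sub_cancel_left] at h5
        gcongr
      rw [← Real.exp_add]
      refine mul_le_mul h4 (Real.exp_le_exp.2 (max_le (hexp1 x h hh) (by linarith)))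
        (Real.exp_pos _).le (by positivity)
    rw [e]
    calc _ ≤ Real.exp (-ρ * |x + h|) * |P (x + h) - P x|
          + |Real.exp (-ρ * |x + h|) - Real.exp (-ρ * |x|)| * |P x| := by
          refine (abs_add_le _ _).trans ?_
          rw [abs_mul, abs_mul, abs_of_pos (Real.exp_pos _)]
      _ ≤ (Real.exp ρ * Real.exp (-ρ * |x|)) * (B * |h|)
          + (ρ * |h| * (Real.exp ρ * Real.exp (-ρ * |x|))) * B := by
          have := hexp x h hh
          gcongr
      _ = B * (Real.exp ρ * (1 + ρ) + 0) * |h| * Real.exp (-ρ * |x|) := by ring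
      _ ≤ _ := by gcongr; norm_num

/-! ### Correlations of localized profiles -/

/-- The correlation `∫ u(x) q(x - τ) dx`. -/
noncomputable def corr (u q : ℝ → ℝ) (τ : ℝ) : ℝ := ∫ x : ℝ, u x * q (x - τ)

lemma integrable_exp_neg_mul_abs {c : ℝ} (hc : 0 < c) :
    Integrable (fun x : ℝ => Real.exp (-c * |x|)) := by
  rw [← integrableOn_univ, ← Set.Iic_union_Ioi (a := (0 : ℝ))]
  refine IntegrableOn.union ?_ ?_
  · refine (integrableOn_exp_mul_Iic hc 0).congr_fun (fun x hx => ?_) measurableSet_Iic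
    simp [abs_of_nonpos (show x ≤ 0 from hx)]
  · refine (integrableOn_exp_mul_Ioi (neg_neg_of_pos hc) 0).congr_fun (fun x hx => ?_)
      measurableSet_Ioi
    simp [abs_of_pos (show 0 < x from hx)]

/-- Triangle inequality |τ| ≤ |x| + |x - τ|. Spending only σ < ρ on decay in τ leaves a weight that
is integrable in x. -/
lemma exp_mul_exp_le {ρ σ : ℝ} (hσ : 0 ≤ σ) (hσρ : σ < ρ) (x τ : ℝ) :
    Real.exp (-ρ * |x|) * Real.exp (-ρ * |x - τ|)
      ≤ Real.exp (-σ * |τ|) * Real.exp (-(ρ - σ) * |x|) := by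
  rw [← Real.exp_add, ← Real.exp_add]
  refine Real.exp_le_exp.2 ?_
  have h : |τ| ≤ |x| + |x - τ| := by
    have := abs_sub x (x - τ)
    rwa [sub_sub_cancel] at this
  nlinarith [abs_nonneg (x - τ), abs_nonneg x]

lemma abs_integral_le_of_exp {ρ σ D τ : ℝ} {f : ℝ → ℝ} (hσ : 0 ≤ σ) (hσρ : σ < ρ) (hD : 0 ≤ D)
    (hf : ∀ᵐ x : ℝ, |f x| ≤ D * (Real.exp (-ρ * |x|) * Real.exp (-ρ * |x - τ|))) :
    |∫ x, f x| ≤ D * (∫ x : ℝ, Real.exp (-(ρ - σ) * |x|)) * Real.exp (-σ * |τ|) := by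
  have h1 : D * (∫ x : ℝ, Real.exp (-(ρ - σ) * |x|)) * Real.exp (-σ * |τ|)
      = ∫ x : ℝ, D * Real.exp (-σ * |τ|) * Real.exp (-(ρ - σ) * |x|) := by
    rw [integral_const_mul]; ring
  rw [h1, ← Real.norm_eq_abs]
  refine norm_integral_le_of_norm_le
    ((integrable_exp_neg_mul_abs (by linarith)).const_mul _) ?_
  filter_upwards [hf] with x hx
  refine hx.trans ?_
  rw [mul_assoc]
  exact mul_le_mul_of_nonneg_left (exp_mul_exp_le hσ hσρ x τ) hD

lemma Localized.nonneg {C ρ : ℝ} {q : ℝ → ℝ} (hq : Localized C ρ q) : 0 ≤ C := by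
  obtain ⟨x, hx⟩ := hq.bound.exists
  exact nonneg_of_mul_nonneg_left ((abs_nonneg _).trans hx) (Real.exp_pos _)

lemma Localized.bound_sub {C ρ : ℝ} {q : ℝ → ℝ} (hq : Localized C ρ q) (τ : ℝ) :
    ∀ᵐ x : ℝ, |q (x - τ)| ≤ C * Real.exp (-ρ * |x - τ|) :=
  ae_comp_sub_right hq.bound τ

lemma Localized.meas_sub {C ρ : ℝ} {q : ℝ → ℝ} (hq : Localized C ρ q) (τ : ℝ) :
    AEStronglyMeasurable (fun x => q (x - τ)) volume :=
  hq.meas.comp_measurePreserving (measurePreserving_sub_right volume τ)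

lemma Localized.integrable {C ρ : ℝ} {q : ℝ → ℝ} (hρ : 0 < ρ) (hq : Localized C ρ q) :
    Integrable q :=
  ((integrable_exp_neg_mul_abs hρ).const_mul C).mono' hq.meas hq.bound

section Correlation

variable {C D ρ σ : ℝ} {u q : ℝ → ℝ}

lemma integrable_mul_localized (hρ : 0 < ρ) (hum : AEStronglyMeasurable u volume)
    (hu : ∀ᵐ x : ℝ, |u x| ≤ D * Real.exp (-ρ * |x|)) (hq : Localized C ρ q) (τ : ℝ) :
    Integrable (fun x => u x * q (x - τ)) := by
  have h1 : Integrable u := ((integrable_exp_neg_mul_abs hρ).const_mul D).mono' hum hu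
  refine h1.mul_bdd (c := C) (hq.meas_sub τ) ?_
  filter_upwards [hq.bound_sub τ] with x hx
  refine hx.trans (mul_le_of_le_one_right hq.nonneg ?_)
  exact Real.exp_le_one_iff.2 (by nlinarith [abs_nonneg (x - τ)])

lemma abs_corr_le (hσ : 0 ≤ σ) (hσρ : σ < ρ) (hD : 0 ≤ D)
    (hu : ∀ᵐ x : ℝ, |u x| ≤ D * Real.exp (-ρ * |x|)) (hq : Localized C ρ q) (τ : ℝ) :
    |corr u q τ| ≤ D * C * (∫ x : ℝ, Real.exp (-(ρ - σ) * |x|)) * Real.exp (-σ * |τ|) := by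
  refine abs_integral_le_of_exp hσ hσρ (mul_nonneg hD hq.nonneg) ?_
  filter_upwards [hu, hq.bound_sub τ] with x h1 h2
  rw [abs_mul]
  calc |u x| * |q (x - τ)| ≤ (D * Real.exp (-ρ * |x|)) * (C * Real.exp (-ρ * |x - τ|)) := by
        gcongr
    _ = _ := by ring

/-- The increment falls entirely on `q`, so `u` needs decay but no regularity. This is why a merely
bounded weighted initial field is admissible. -/
lemma abs_corr_add_sub_le (hσ : 0 ≤ σ) (hσρ : σ < ρ) (hD : 0 ≤ D)
    (hum : AEStronglyMeasurable u volume)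
    (hu : ∀ᵐ x : ℝ, |u x| ≤ D * Real.exp (-ρ * |x|)) (hq : Localized C ρ q) (τ : ℝ) {h : ℝ}
    (hh : |h| ≤ 1) :
    |corr u q (τ + h) - corr u q τ|
      ≤ D * C * (∫ x : ℝ, Real.exp (-(ρ - σ) * |x|)) * |h| * Real.exp (-σ * |τ|) := by
  have hρ : 0 < ρ := hσ.trans_lt hσρ
  have e : corr u q (τ + h) - corr u q τ = ∫ x, u x * (q (x - τ + -h) - q (x - τ)) := by
    rw [corr, corr, ← integral_sub (integrable_mul_localized hρ hum hu hq _)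
      (integrable_mul_localized hρ hum hu hq _)]
    congr 1
    ext x
    rw [mul_sub, ← sub_eq_add_neg, sub_sub]
  have h1 : D * C * (∫ x : ℝ, Real.exp (-(ρ - σ) * |x|)) * |h| * Real.exp (-σ * |τ|)
      = D * C * |h| * (∫ x : ℝ, Real.exp (-(ρ - σ) * |x|)) * Real.exp (-σ * |τ|) := by ring
  rw [e, h1]
  refine abs_integral_le_of_exp hσ hσρ
    (mul_nonneg (mul_nonneg hD hq.nonneg) (abs_nonneg h)) ?_
  filter_upwards [hu, ae_comp_sub_right (hq.lip (-h) (by rwa [abs_neg])) τ] with x h1 h2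
  rw [abs_neg] at h2
  rw [abs_mul]
  calc _ ≤ (D * Real.exp (-ρ * |x|)) * (C * |h| * Real.exp (-ρ * |x - τ|)) := by
        gcongr
    _ = _ := by ring

lemma continuous_of_abs_add_sub_le {f : ℝ → ℝ} {M : ℝ}
    (hf : ∀ τ h : ℝ, |h| ≤ 1 → |f (τ + h) - f τ| ≤ M * |h|) : Continuous f := by
  refine continuous_iff_continuousAt.2 fun τ => ?_
  rw [ContinuousAt, tendsto_iff_norm_sub_tendsto_zero]
  have h1 : Tendsto (fun s => M * |s - τ|) (nhds τ) (nhds 0) := by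
    have : Continuous fun s => M * |s - τ| := by fun_prop
    simpa using this.tendsto τ
  refine squeeze_zero' (Eventually.of_forall fun s => norm_nonneg _) ?_ h1
  filter_upwards [Metric.ball_mem_nhds τ one_pos] with s hs
  have := hf τ (s - τ) (le_of_lt (by simpa [Real.dist_eq] using hs))
  simpa using this

lemma continuous_corr (hρ : 0 < ρ) (hD : 0 ≤ D) (hum : AEStronglyMeasurable u volume)
    (hu : ∀ᵐ x : ℝ, |u x| ≤ D * Real.exp (-ρ * |x|)) (hq : Localized C ρ q) :
    Continuous (corr u q) :=
  continuous_of_abs_add_sub_le fun τ h hh => by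
    have := abs_corr_add_sub_le le_rfl hρ hD hum hu hq τ hh
    simpa using this

lemma expLip_corr (hσ : 0 ≤ σ) (hσρ : σ < ρ) (hD : 0 ≤ D)
    (hum : AEStronglyMeasurable u volume)
    (hu : ∀ᵐ x : ℝ, |u x| ≤ D * Real.exp (-ρ * |x|)) (hq : Localized C ρ q) :
    ExpLip (D * C * ∫ x : ℝ, Real.exp (-(ρ - σ) * |x|)) σ (corr u q) where
  bound s hs := by
    have := abs_corr_le hσ hσρ hD hu hq s
    rwa [abs_of_nonneg hs] at this
  lip s hs h hh0 hh1 := by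
    have := abs_corr_add_sub_le hσ hσρ hD hum hu hq s (h := h) (by rwa [abs_of_nonneg hh0])
    rwa [abs_of_nonneg hs, abs_of_nonneg hh0] at this

end Correlation

lemma corr_neg (q : ℝ → ℝ) (τ : ℝ) : corr q q (-τ) = corr q q τ := by
  rw [corr, corr, ← integral_sub_right_eq_self (fun x => q x * q (x - -τ)) τ]
  congr 1
  ext x
  rw [sub_neg_eq_add, sub_add_cancel, mul_comm]

/-! ### The cosine transform of the autocorrelation -/

lemma normSq_integral_exp_mul {q : ℝ → ℝ} (hq : Integrable q) (ω : ℝ) :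
    ‖∫ x : ℝ, Complex.exp (-(Complex.I * (ω : ℂ) * (x : ℂ))) * (q x : ℂ)‖ ^ 2
      = (∫ x, Real.cos (ω * x) * q x) ^ 2 + (∫ x, Real.sin (ω * x) * q x) ^ 2 := by
  have hi : Integrable fun x : ℝ => Complex.exp (-(Complex.I * (ω : ℂ) * (x : ℂ))) * (q x : ℂ) := by
    refine hq.ofReal.bdd_mul (c := 1) (by fun_prop) (ae_of_all _ fun x => ?_)
    rw [Complex.norm_exp]
    simp
  have e : ∀ x : ℝ, Complex.exp (-(Complex.I * (ω : ℂ) * (x : ℂ))) * (q x : ℂ)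
      = ((Real.cos (ω * x) * q x : ℝ) : ℂ) + ((-(Real.sin (ω * x) * q x) : ℝ) : ℂ) * Complex.I := by
    intro x
    have : -(Complex.I * (ω : ℂ) * (x : ℂ)) = ((-(ω * x) : ℝ) : ℂ) * Complex.I := by
      push_cast; ring
    rw [this, Complex.exp_mul_I, ← Complex.ofReal_cos, ← Complex.ofReal_sin, Real.cos_neg,
      Real.sin_neg]
    push_cast
    ring
  have hre : (∫ x : ℝ, Complex.exp (-(Complex.I * (ω : ℂ) * (x : ℂ))) * (q x : ℂ)).re
      = ∫ x, Real.cos (ω * x) * q x := by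
    have := integral_re hi
    simp only [RCLike.re_to_complex] at this
    rw [← this]
    congr 1
    ext x
    rw [e, Complex.add_re, Complex.re_ofReal_mul, Complex.ofReal_re, Complex.I_re, mul_zero,
      add_zero]
  have him : (∫ x : ℝ, Complex.exp (-(Complex.I * (ω : ℂ) * (x : ℂ))) * (q x : ℂ)).im
      = -∫ x, Real.sin (ω * x) * q x := by
    have := integral_im hi
    simp only [RCLike.im_to_complex] at this
    rw [← this, ← integral_neg]
    congr 1
    ext x
    rw [e, Complex.add_im, Complex.im_ofReal_mul, Complex.ofReal_im, Complex.I_im, mul_one,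
      zero_add]
  rw [← Complex.normSq_eq_norm_sq, Complex.normSq_apply, hre, him]
  ring

/-- Wiener-Khinchin: after Fubini and τ = x - y, the addition formula for cos(ω(x - y)) splits the
double integral into squares. -/
lemma integral_cos_mul_corr {q : ℝ → ℝ} (hq : Integrable q) (ω : ℝ) :
    ∫ τ, Real.cos (ω * τ) * corr q q τ
      = (∫ x, Real.cos (ω * x) * q x) ^ 2 + (∫ x, Real.sin (ω * x) * q x) ^ 2 := by
  have hint : Integrable (Function.uncurry fun τ x : ℝ => Real.cos (ω * τ) * (q x * q (x - τ)))
      ((volume : Measure ℝ).prod volume) := by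
    have h1 := hq.convolution_integrand (ContinuousLinearMap.mul ℝ ℝ) hq.comp_neg
    have h2 := h1.bdd_mul (c := 1) (f := fun z : ℝ × ℝ => Real.cos (ω * z.1)) (by fun_prop)
      (ae_of_all _ fun z => Real.abs_cos_le_one _)
    simpa [Function.uncurry_def] using h2
  have hc : Integrable fun x => Real.cos (ω * x) * q x :=
    hq.bdd_mul (c := 1) (by fun_prop) (ae_of_all _ fun z => Real.abs_cos_le_one _)
  have hs : Integrable fun x => Real.sin (ω * x) * q x :=
    hq.bdd_mul (c := 1) (by fun_prop) (ae_of_all _ fun z => Real.abs_sin_le_one _)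
  set c := ∫ x, Real.cos (ω * x) * q x with hcdef
  set s := ∫ x, Real.sin (ω * x) * q x with hsdef
  have hinner : ∀ x, ∫ τ, Real.cos (ω * τ) * (q x * q (x - τ))
      = c * (Real.cos (ω * x) * q x) + s * (Real.sin (ω * x) * q x) := by
    intro x
    rw [← integral_sub_left_eq_self _ volume x]
    have : ∀ y, Real.cos (ω * (x - y)) * (q x * q (x - (x - y)))
        = (Real.cos (ω * x) * q x) * (Real.cos (ω * y) * q y)
          + (Real.sin (ω * x) * q x) * (Real.sin (ω * y) * q y) := by
      intro y
      rw [sub_sub_cancel, mul_sub, Real.cos_sub]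
      ring
    simp only [this]
    rw [integral_add (hc.const_mul _) (hs.const_mul _), integral_const_mul, integral_const_mul]
    ring
  calc ∫ τ, Real.cos (ω * τ) * corr q q τ
      = ∫ τ, ∫ x, Real.cos (ω * τ) * (q x * q (x - τ)) := by
        simp only [corr, integral_const_mul]
    _ = ∫ x, ∫ τ, Real.cos (ω * τ) * (q x * q (x - τ)) := integral_integral_swap hint
    _ = c ^ 2 + s ^ 2 := by
        simp only [hinner]
        rw [integral_add (hc.const_mul _) (hs.const_mul _), integral_const_mul,
          integral_const_mul, ← hcdef, ← hsdef]
        ring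

/-- The integrand is even, so the half line carries half of |∫ exp(-iωx) q|² = 4π²|q̂(ω)|². -/
lemma integral_Ioi_cos_mul_corr {q : ℝ → ℝ} (hq : Integrable q) (ω : ℝ) :
    ∫ τ in Set.Ioi 0, Real.cos (ω * τ) * corr q q τ
      = 2 * Real.pi ^ 2 * ‖fourierHat q ω‖ ^ 2 := by
  have h1 := integral_comp_abs (f := fun τ => Real.cos (ω * τ) * corr q q τ)
  have h2 : ∀ τ : ℝ, Real.cos (ω * |τ|) * corr q q |τ| = Real.cos (ω * τ) * corr q q τ := by
    intro τ
    rcases abs_choice τ with h | h <;> rw [h]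
    rw [corr_neg, mul_neg, Real.cos_neg]
  simp only [h2] at h1
  rw [integral_cos_mul_corr hq, ← normSq_integral_exp_mul hq] at h1
  have hpi : ‖(1 / (2 * (Real.pi : ℂ)))‖ = 1 / (2 * Real.pi) := by
    simp [abs_of_pos Real.pi_pos]
  rw [fourierHat, norm_mul, hpi, mul_pow, h1]
  field_simp

/-! ### Linear Volterra equations on the half line -/

lemma integral_triangle_swap {F : ℝ → ℝ → ℝ} (hF : Continuous (Function.uncurry F)) {t : ℝ}
    (ht : 0 ≤ t) :
    ∫ r in (0 : ℝ)..t, ∫ s in (0 : ℝ)..r, F r s = ∫ s in (0 : ℝ)..t, ∫ r in s..t, F r s := by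
  have hms : MeasurableSet {z : ℝ × ℝ | z.2 ≤ z.1} := measurableSet_le measurable_snd measurable_fst
  have hint : IntegrableOn
      (Function.uncurry fun r s => Set.indicator {z : ℝ × ℝ | z.2 ≤ z.1} (Function.uncurry F) (r, s))
      (Set.uIoc 0 t ×ˢ Set.uIoc 0 t) := by
    have h1 : IntegrableOn (Function.uncurry F) (Set.uIcc 0 t ×ˢ Set.uIcc 0 t) :=
      hF.continuousOn.integrableOn_compact (isCompact_uIcc.prod isCompact_uIcc)
    have h2 := h1.mono_set (Set.prod_mono Set.uIoc_subset_uIcc Set.uIoc_subset_uIcc)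
    exact h2.indicator hms
  have hswap := intervalIntegral_intervalIntegral_swap hint
  have hl : ∀ r ∈ Set.uIcc 0 t, ∫ s in (0 : ℝ)..t,
      Set.indicator {z : ℝ × ℝ | z.2 ≤ z.1} (Function.uncurry F) (r, s)
        = ∫ s in (0 : ℝ)..r, F r s := by
    intro r hr
    rw [Set.uIcc_of_le ht] at hr
    rw [← intervalIntegral.integral_indicator hr]
    rfl
  have hr : ∀ s ∈ Set.uIcc 0 t, ∫ r in (0 : ℝ)..t,
      Set.indicator {z : ℝ × ℝ | z.2 ≤ z.1} (Function.uncurry F) (r, s)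
        = ∫ r in s..t, F r s := by
    intro s hs
    rw [Set.uIcc_of_le ht] at hs
    have e : (fun r => Set.indicator {z : ℝ × ℝ | z.2 ≤ z.1} (Function.uncurry F) (r, s))
        = Set.indicator (Set.Ici s) fun r => F r s := by
      ext r
      simp [Set.indicator_apply]
    rw [e, intervalIntegral.integral_of_le ht, setIntegral_indicator measurableSet_Ici,
      intervalIntegral.integral_of_le hs.2]
    refine setIntegral_congr_set ?_
    have hsub : (Set.Ioc 0 t ∩ Set.Ici s : Set ℝ) =ᵐ[volume] (Set.Ioc 0 t ∩ Set.Ioi s : Set ℝ) :=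
      (ae_eq_refl _).inter Ioi_ae_eq_Ici.symm
    have hset : (Set.Ioc 0 t ∩ Set.Ioi s : Set ℝ) = Set.Ioc s t := by
      ext x
      simp only [Set.mem_inter_iff, Set.mem_Ioc, Set.mem_Ioi]
      exact ⟨fun h => ⟨h.2, h.1.2⟩, fun h => ⟨⟨hs.1.trans_lt h.1, h.2⟩, h.1⟩⟩
    rwa [hset] at hsub
  rw [← intervalIntegral.integral_congr hl, ← intervalIntegral.integral_congr hr]
  exact hswap

/-- Integrated form of `a' = f - K ∗ a` after multiplication by `exp(θ t)`: the kernel becomes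
the antiderivative `N` of `-exp(θ s) K(s)` with `N(0) = θ`. -/
lemma volterra_integrated {a f K N : ℝ → ℝ} {θ : ℝ} (hf : Continuous f) (hK : Continuous K)
    (ha : Continuous a)
    (hd : ∀ t, 0 ≤ t → HasDerivAt a (f t - ∫ s in (0 : ℝ)..t, K (t - s) * a s) t)
    (hN : ∀ t, 0 ≤ t → N t = θ - ∫ s in (0 : ℝ)..t, Real.exp (θ * s) * K s) {t : ℝ} (ht : 0 ≤ t) :
    Real.exp (θ * t) * a t = a 0 + (∫ s in (0 : ℝ)..t, Real.exp (θ * s) * f s)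
      + ∫ s in (0 : ℝ)..t, N (t - s) * (Real.exp (θ * s) * a s) := by
  set k : ℝ → ℝ := fun s => Real.exp (θ * s) * K s with hk
  set A : ℝ → ℝ := fun s => Real.exp (θ * s) * a s with hA
  have hkc : Continuous k := by fun_prop
  have hAc : Continuous A := by fun_prop
  have hAd : ∀ r, 0 ≤ r → HasDerivAt A (θ * A r + Real.exp (θ * r) * f r
      - ∫ s in (0 : ℝ)..r, k (r - s) * A s) r := by
    intro r hr
    have he : HasDerivAt (fun s => Real.exp (θ * s)) (Real.exp (θ * r) * θ) r := by
      simpa using ((hasDerivAt_id r).const_mul θ).exp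
    have h1 := he.mul (hd r hr)
    have h2 : Real.exp (θ * r) * ∫ s in (0 : ℝ)..r, K (r - s) * a s
        = ∫ s in (0 : ℝ)..r, k (r - s) * A s := by
      rw [← intervalIntegral.integral_const_mul]
      congr 1
      ext s
      have : Real.exp (θ * r) = Real.exp (θ * (r - s)) * Real.exp (θ * s) := by
        rw [← Real.exp_add]; ring_nf
      rw [this, hk, hA]
      ring
    refine h1.congr_deriv ?_
    rw [mul_sub, h2, hA]
    ring
  have hconv : Continuous fun r => ∫ s in (0 : ℝ)..r, k (r - s) * A s :=
    intervalIntegral.continuous_parametric_intervalIntegral_of_continuous (by fun_prop)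
      continuous_id
  have hfc : Continuous fun r => Real.exp (θ * r) * f r := by fun_prop
  have hftc := intervalIntegral.integral_eq_sub_of_hasDerivAt (a := 0) (b := t) (f := A)
    (fun r hr => hAd r (by rw [Set.uIcc_of_le ht] at hr; exact hr.1))
    (Continuous.intervalIntegrable (by fun_prop) _ _)
  rw [intervalIntegral.integral_sub (Continuous.intervalIntegrable (by fun_prop) _ _)
      (hconv.intervalIntegrable _ _),
    intervalIntegral.integral_add (Continuous.intervalIntegrable (by fun_prop) _ _)
      (hfc.intervalIntegrable _ _), integral_triangle_swap (by fun_prop) ht] at hftc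
  -- After the swap the inner integral is a primitive of `k`, that is (θ - N(t - s)) A(s). Its θ
  -- part cancels the θA produced by differentiating exp(θt), leaving the convolution with `N`.
  have hinner : ∀ s ∈ Set.uIcc 0 t, ∫ r in s..t, k (r - s) * A s = θ * A s - N (t - s) * A s := by
    intro s hs
    rw [Set.uIcc_of_le ht] at hs
    rw [intervalIntegral.integral_mul_const, intervalIntegral.integral_comp_sub_right, sub_self,
      hN (t - s) (by linarith [hs.2])]
    ring
  have hinner' : ∀ s ∈ Set.uIcc 0 t, N (t - s) * A s
      = θ * A s - ∫ r in s..t, k (r - s) * A s := fun s hs => by rw [hinner s hs]; ring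
  have hpc : Continuous fun s => ∫ r in s..t, k (r - s) * A s := by
    have e : (fun s => ∫ r in s..t, k (r - s) * A s)
        = fun s => (∫ r in (0 : ℝ)..(t - s), k r) * A s := by
      ext s
      rw [intervalIntegral.integral_mul_const, intervalIntegral.integral_comp_sub_right, sub_self]
    rw [e]
    exact ((intervalIntegral.continuous_primitive (fun _ _ => hkc.intervalIntegrable _ _) 0).comp
      (by fun_prop)).mul hAc
  have hA0 : A 0 = a 0 := by simp [hA]
  have : ∫ s in (0 : ℝ)..t, N (t - s) * A s
      = (∫ s in (0 : ℝ)..t, θ * A s) - ∫ s in (0 : ℝ)..t, ∫ r in s..t, k (r - s) * A s := by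
    rw [← intervalIntegral.integral_sub (Continuous.intervalIntegrable (by fun_prop) _ _)
      (hpc.intervalIntegrable _ _)]
    exact intervalIntegral.integral_congr hinner'
  rw [hA0] at hftc
  change A t = _
  rw [this]
  linarith

/-- Let m be the maximum of exp(μs)|B(s)| on the compact interval [0, t]. At a maximizer the
convolution contributes at most m ε/(lam - μ) ≤ m/2, so m ≤ D + m/2. Working on [0, t] removes the
need for an a priori bound on the half line. -/
lemma volterra_decay {B w N : ℝ → ℝ} {D ε lam μ : ℝ} (hB : Continuous B)
    (hw : ∀ t, 0 ≤ t → |w t| ≤ D * Real.exp (-μ * t))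
    (hN : ∀ t, 0 ≤ t → |N t| ≤ ε * Real.exp (-lam * t)) (hμ : μ < lam)
    (hε : ε / (lam - μ) ≤ 1 / 2)
    (heq : ∀ t, 0 ≤ t → B t = w t + ∫ s in (0 : ℝ)..t, N (t - s) * B s) {t : ℝ} (ht : 0 ≤ t) :
    |B t| ≤ 2 * D * Real.exp (-μ * t) := by
  have hc : 0 < lam - μ := by linarith
  have hε0 : 0 ≤ ε := by simpa using (abs_nonneg _).trans (hN 0 le_rfl)
  have hgc : Continuous fun s => Real.exp (μ * s) * |B s| := by fun_prop
  obtain ⟨T, hT, hmax⟩ := (isCompact_Icc (a := (0 : ℝ)) (b := t)).exists_isMaxOn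
    ⟨0, le_rfl, ht⟩ hgc.continuousOn
  set m := Real.exp (μ * T) * |B T| with hm
  have hbd : ∀ s ∈ Set.Icc 0 t, |B s| ≤ m * Real.exp (-μ * s) := by
    intro s hs
    have h1 : Real.exp (μ * s) * |B s| ≤ m := hmax hs
    calc |B s| = Real.exp (μ * s) * |B s| * Real.exp (-μ * s) := by
          rw [mul_right_comm, ← Real.exp_add]; simp
      _ ≤ _ := by gcongr
  have hm0 : 0 ≤ m := by positivity
  have hint : |∫ s in (0 : ℝ)..T, N (T - s) * B s| ≤ m / 2 * Real.exp (-μ * T) := by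
    have h1 : |∫ s in (0 : ℝ)..T, N (T - s) * B s|
        ≤ ∫ s in (0 : ℝ)..T, ε * m * Real.exp (-μ * T) * Real.exp (-(lam - μ) * (T - s)) := by
      have hgc' : Continuous fun s =>
          ε * m * Real.exp (-μ * T) * Real.exp (-(lam - μ) * (T - s)) := by fun_prop
      rw [← Real.norm_eq_abs]
      refine intervalIntegral.norm_integral_le_of_norm_le hT.1 (ae_of_all _ fun s hs => ?_)
        (hgc'.intervalIntegrable (μ := volume) _ _)
      rw [Real.norm_eq_abs, abs_mul]
      have e : Real.exp (-μ * T) * Real.exp (-(lam - μ) * (T - s))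
          = Real.exp (-lam * (T - s)) * Real.exp (-μ * s) := by
        rw [← Real.exp_add, ← Real.exp_add]; ring_nf
      calc |N (T - s)| * |B s|
          ≤ (ε * Real.exp (-lam * (T - s))) * (m * Real.exp (-μ * s)) :=
            mul_le_mul (hN _ (by linarith [hs.2])) (hbd s ⟨hs.1.le, hs.2.trans hT.2⟩)
              (abs_nonneg _) (by positivity)
        _ = _ := by rw [mul_assoc (ε * m), e]; ring
    have h2 : ∫ s in (0 : ℝ)..T, Real.exp (-(lam - μ) * (T - s)) ≤ 1 / (lam - μ) := by
      rw [intervalIntegral.integral_comp_sub_left (fun s => Real.exp (-(lam - μ) * s)), sub_self,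
        sub_zero, intervalIntegral.integral_comp_mul_left _ (by linarith : -(lam - μ) ≠ 0)]
      rw [integral_exp, mul_zero, Real.exp_zero, smul_eq_mul, inv_neg, neg_mul, ← mul_neg,
        neg_sub, one_div]
      refine mul_le_of_le_one_right (by positivity) ?_
      linarith [Real.exp_pos (-(lam - μ) * T)]
    rw [intervalIntegral.integral_const_mul] at h1
    refine h1.trans ?_
    calc _ ≤ ε * m * Real.exp (-μ * T) * (1 / (lam - μ)) := by gcongr
      _ = ε / (lam - μ) * (m * Real.exp (-μ * T)) := by ring
      _ ≤ 1 / 2 * (m * Real.exp (-μ * T)) := by gcongr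
      _ = _ := by ring
  have h3 : |B T| ≤ (D + m / 2) * Real.exp (-μ * T) := by
    rw [heq T hT.1, add_mul]
    exact (abs_add_le _ _).trans (add_le_add (hw T hT.1) hint)
  have h4 : m ≤ D + m / 2 := by
    calc m ≤ Real.exp (μ * T) * ((D + m / 2) * Real.exp (-μ * T)) := by
          rw [hm]; gcongr
      _ = (D + m / 2) * (Real.exp (μ * T) * Real.exp (-μ * T)) := by ring
      _ = _ := by rw [← Real.exp_add]; simp
  refine (hbd t ⟨ht, le_rfl⟩).trans ?_
  gcongr
  linarith

/-- The relation for α matches the constants at infinity: A - α then solves the same Volterra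
equation, driven only by the tails of `φ` and of α `N`, and `volterra_decay` applies. -/
lemma volterra_asymptotics {A φ N : ℝ → ℝ} {a₀ D ε lam μ α : ℝ} (hA : Continuous A)
    (hφ : Continuous φ) (hNc : Continuous N)
    (hφb : ∀ t, 0 ≤ t → |φ t| ≤ D * Real.exp (-lam * t))
    (hN : ∀ t, 0 ≤ t → |N t| ≤ ε * Real.exp (-lam * t)) (hμ0 : 0 < μ) (hμ : μ < lam)
    (hε : ε / (lam - μ) ≤ 1 / 2)
    (hα : α * (1 - ∫ s in Set.Ioi 0, N s) = a₀ + ∫ s in Set.Ioi 0, φ s)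
    (heq : ∀ t, 0 ≤ t → A t = a₀ + (∫ s in (0 : ℝ)..t, φ s) + ∫ s in (0 : ℝ)..t, N (t - s) * A s) :
    ∃ M : ℝ, ∀ t, 0 ≤ t → |A t - α| ≤ M * Real.exp (-μ * t) := by
  have hl : 0 < lam := hμ0.trans hμ
  have hD0 : 0 ≤ D := by simpa using (abs_nonneg _).trans (hφb 0 le_rfl)
  have hε0 : 0 ≤ ε := by simpa using (abs_nonneg _).trans (hN 0 le_rfl)
  have htail : ∀ g : ℝ → ℝ, Continuous g → ∀ E, (∀ t, 0 ≤ t → |g t| ≤ E * Real.exp (-lam * t)) →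
      ∀ t, 0 ≤ t → (∫ s in (0 : ℝ)..t, g s)
        = (∫ s in Set.Ioi 0, g s) - ∫ s in Set.Ioi t, g s := fun g hg E hE t ht =>
    (intervalIntegral.integral_Ioi_sub_Ioi
      (integrableOn_Ioi_of_abs_le hl hg fun s hs => hE s hs.le) ht).symm
  refine ⟨2 * (D / lam + |α| * (ε / lam)), fun t ht => ?_⟩
  refine volterra_decay (B := fun t => A t - α) (N := N) (ε := ε) (lam := lam)
    (w := fun t => -((∫ s in Set.Ioi t, φ s) + α * ∫ s in Set.Ioi t, N s)) (by fun_prop)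
    (fun r hr => ?_) hN hμ hε (fun r hr => ?_) ht
  · have h1 := abs_integral_Ioi_le (t := r) hl fun s hs => hφb s (hr.trans hs.le)
    have h2 := abs_integral_Ioi_le (t := r) hl fun s hs => hN s (hr.trans hs.le)
    have h3 : Real.exp (-lam * r) ≤ Real.exp (-μ * r) := Real.exp_le_exp.2 (by nlinarith)
    rw [abs_neg]
    calc _ ≤ |∫ s in Set.Ioi r, φ s| + |α| * |∫ s in Set.Ioi r, N s| := by
          rw [← abs_mul]; exact abs_add_le _ _
      _ ≤ D / lam * Real.exp (-lam * r) + |α| * (ε / lam * Real.exp (-lam * r)) := by gcongr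
      _ = (D / lam + |α| * (ε / lam)) * Real.exp (-lam * r) := by ring
      _ ≤ _ := by gcongr
  · have h1 : ∫ s in (0 : ℝ)..r, N (r - s) * (A s - α)
        = (∫ s in (0 : ℝ)..r, N (r - s) * A s) - (∫ s in (0 : ℝ)..r, N s) * α := by
      simp only [mul_sub]
      rw [intervalIntegral.integral_sub (Continuous.intervalIntegrable (by fun_prop) _ _)
        (Continuous.intervalIntegrable (by fun_prop) _ _), intervalIntegral.integral_mul_const,
        intervalIntegral.integral_comp_sub_left, sub_self, sub_zero]
    rw [h1, heq r hr, htail φ hφ D hφb r hr, htail N hNc ε hN r hr]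
    linear_combination -hα

/-! ### The decay rate as a fixed point -/

/-- The kernel `exp(θ s) cos(ω s) G(s)`. -/
noncomputable def modulatedKernel (G : ℝ → ℝ) (ω θ s : ℝ) : ℝ :=
  Real.exp (θ * s) * (Real.cos (ω * s) * G s)

section Rate

variable {G : ℝ → ℝ} {C₀ κ : ℝ}

lemma continuous_modulatedKernel (hG : Continuous G) (ω θ : ℝ) :
    Continuous (modulatedKernel G ω θ) := by
  unfold modulatedKernel
  fun_prop

lemma abs_modulatedKernel_le (hGe : ExpLip C₀ (15 * κ) G) {θ : ℝ} (hθ : |θ| ≤ κ)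
    (ω : ℝ) {s : ℝ} (hs : 0 ≤ s) :
    |modulatedKernel G ω θ s| ≤ C₀ * Real.exp (-(14 * κ) * s) := by
  have h2 : θ ≤ κ := (le_abs_self _).trans hθ
  have hC := hGe.nonneg
  rw [modulatedKernel, abs_mul, abs_mul, abs_of_pos (Real.exp_pos _)]
  calc _ ≤ Real.exp (κ * s) * (1 * (C₀ * Real.exp (-(15 * κ) * s))) := by
        have := hGe.bound s hs
        have := Real.abs_cos_le_one (ω * s)
        gcongr
    _ = C₀ * (Real.exp (κ * s) * Real.exp (-(15 * κ) * s)) := by ring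
    _ = _ := by rw [← Real.exp_add]; ring_nf

lemma exists_abs_integral_modulatedKernel_le (hκ : 0 < κ) (hG : Continuous G)
    (hGe : ExpLip C₀ (15 * κ) G) :
    ∃ C : ℝ, 0 ≤ C ∧ ∀ θ ω t : ℝ, |θ| ≤ κ → Real.pi ≤ ω → 0 ≤ t →
      |∫ s in Set.Ioi t, modulatedKernel G ω θ s| ≤ C / ω * Real.exp (-(14 * κ) * t) := by
  refine ⟨(Real.pi / 2 * (1 + 1 / (14 * κ)))
    * ((1 + κ * Real.exp κ) * C₀ * (Real.exp |-κ| + 1)), ?_, fun θ ω t hθ hω ht => ?_⟩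
  · have := hGe.nonneg
    positivity
  · have h1 := ((expLip_exp hθ).mul hGe).weaken le_rfl (show 14 * κ ≤ -κ + 15 * κ by linarith)
    have h2 := abs_integral_cos_mul_le (by fun_prop) h1 (by linarith) hω ht
    have e : ∀ s, modulatedKernel G ω θ s = Real.cos (ω * s) * (Real.exp (θ * s) * G s) :=
      fun s => by rw [modulatedKernel]; ring
    simp only [e]
    exact h2

/-- The difference is θ times an oscillatory integral with amplitude (exp(θs) - 1)/θ · G(s), to
which the Riemann-Lebesgue bound applies uniformly in θ ≠ 0. -/
lemma exists_abs_integral_modulatedKernel_sub_le (hκ : 0 < κ) (hG : Continuous G)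
    (hGe : ExpLip C₀ (15 * κ) G) :
    ∃ C : ℝ, 0 ≤ C ∧ ∀ θ ω : ℝ, |θ| ≤ κ → Real.pi ≤ ω →
      |(∫ s in Set.Ioi 0, modulatedKernel G ω θ s) - ∫ s in Set.Ioi 0, modulatedKernel G ω 0 s|
        ≤ |θ| * (C / ω) := by
  refine ⟨(Real.pi / 2 * (1 + 1 / (13 * κ)))
    * ((1 / κ + Real.exp κ) * C₀ * (Real.exp |-(2 * κ)| + 1)), ?_, fun θ ω hθ hω => ?_⟩
  · have := hGe.nonneg
    positivity
  · rcases eq_or_ne θ 0 with rfl | hne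
    · simp
    have h1 := ((expLip_exp_sub_one_div hθ hκ hne).mul hGe).weaken le_rfl
      (show 13 * κ ≤ -(2 * κ) + 15 * κ by linarith)
    have h2 := abs_integral_cos_mul_le (by fun_prop) h1 (by linarith) hω le_rfl
    rw [mul_zero, Real.exp_zero, mul_one] at h2
    have hi : ∀ η, |η| ≤ κ → IntegrableOn (modulatedKernel G ω η) (Set.Ioi 0) := fun η hη =>
      integrableOn_Ioi_of_abs_le (lam := 14 * κ) (by linarith) (continuous_modulatedKernel hG ω η)
        fun s hs => abs_modulatedKernel_le hGe hη ω hs.le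
    have e : (∫ s in Set.Ioi 0, modulatedKernel G ω θ s) - ∫ s in Set.Ioi 0, modulatedKernel G ω 0 s
        = θ * ∫ s in Set.Ioi 0, Real.cos (ω * s) * ((Real.exp (θ * s) - 1) / θ * G s) := by
      rw [← integral_sub (hi θ hθ) (hi 0 (by simpa using hκ.le)), ← integral_const_mul]
      congr 1
      ext s
      simp only [modulatedKernel, zero_mul, Real.exp_zero]
      field_simp
    rw [e, abs_mul]
    gcongr

lemma continuousOn_integral_modulatedKernel (hκ : 0 < κ) (hG : Continuous G)
    (hGe : ExpLip C₀ (15 * κ) G) (ω : ℝ) :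
    ContinuousOn (fun θ => ∫ s in Set.Ioi 0, modulatedKernel G ω θ s) (Set.Icc (-κ) κ) := by
  refine continuousOn_of_dominated (bound := fun s => C₀ * Real.exp (-(14 * κ) * s))
    (fun θ _ => (continuous_modulatedKernel hG ω θ).aestronglyMeasurable) (fun θ hθ => ?_)
    (integrableOn_exp_neg_mul_Ioi (by linarith) _ _) (ae_of_all _ fun s => ?_)
  · exact (ae_restrict_iff' measurableSet_Ioi).2 (ae_of_all _ fun s hs =>
      abs_modulatedKernel_le hGe (abs_le.2 hθ) ω (le_of_lt hs))
  · unfold modulatedKernel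
    fun_prop

/-- The continuous function θ - Φ(θ) changes sign on [-κ, κ] because |Φ| ≤ κ there; the intermediate
value theorem suffices, and uniqueness is not needed. -/
lemma exists_eq_integral_modulatedKernel (hκ : 0 < κ) (hG : Continuous G)
    (hGe : ExpLip C₀ (15 * κ) G) {ω : ℝ}
    (hb : ∀ θ, |θ| ≤ κ → |∫ s in Set.Ioi 0, modulatedKernel G ω θ s| ≤ κ) :
    ∃ θ, |θ| ≤ κ ∧ θ = ∫ s in Set.Ioi 0, modulatedKernel G ω θ s := by
  have hc : ContinuousOn (fun θ => θ - ∫ s in Set.Ioi 0, modulatedKernel G ω θ s)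
      (Set.Icc (-κ) κ) :=
    continuousOn_id.sub (continuousOn_integral_modulatedKernel hκ hG hGe ω)
  have h1 := abs_le.1 (hb (-κ) (by rw [abs_neg, abs_of_pos hκ]))
  have h2 := abs_le.1 (hb κ (by rw [abs_of_pos hκ]))
  obtain ⟨θ, hθ, h0⟩ := intermediate_value_Icc (by linarith) hc
    (show (0 : ℝ) ∈ Set.Icc _ _ from ⟨by linarith [h1.1], by linarith [h2.2]⟩)
  exact ⟨θ, abs_le.2 hθ, sub_eq_zero.1 h0⟩

lemma exists_decayRate (hκ : 0 < κ) (hG : Continuous G) (hGe : ExpLip C₀ (15 * κ) G) :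
    ∃ C ω₀ : ℝ, 0 ≤ C ∧ Real.pi ≤ ω₀ ∧ ∀ ω, ω₀ ≤ ω → C / ω / (2 * κ) ≤ 1 / 2 ∧
      ∃ θ e : ℝ, |θ| ≤ κ ∧ |e| ≤ C / ω ∧
        θ = ∫ s in Set.Ioi 0, modulatedKernel G ω θ s ∧
        θ = (∫ s in Set.Ioi 0, Real.cos (ω * s) * G s) * (1 + e) ∧
        ∀ t, 0 ≤ t →
          |∫ s in Set.Ioi t, modulatedKernel G ω θ s| ≤ C / ω * Real.exp (-(14 * κ) * t) := by
  obtain ⟨C₁, hC₁, h₁⟩ := exists_abs_integral_modulatedKernel_le hκ hG hGe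
  obtain ⟨C₂, hC₂, h₂⟩ := exists_abs_integral_modulatedKernel_sub_le hκ hG hGe
  set C := C₁ + 2 * C₂ with hCdef
  have hC : 0 ≤ C := by positivity
  -- π keeps the half-period shift at most 1; C/κ gives C/ω ≤ κ, hence both |Φ| ≤ κ and the
  -- smallness required by the Volterra estimate; C forces the relative error e₁ below 1/2.
  refine ⟨C, max Real.pi (max (C / κ) C), hC, le_max_left _ _, fun ω hω => ?_⟩
  have hω1 : Real.pi ≤ ω := (le_max_left _ _).trans hω
  have hω2 : C / κ ≤ ω := (le_max_left _ _).trans ((le_max_right _ _).trans hω)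
  have hω3 : C ≤ ω := (le_max_right _ _).trans ((le_max_right _ _).trans hω)
  have hω0 : 0 < ω := Real.pi_pos.trans_le hω1
  have hCκ : C / ω ≤ κ := by
    rw [div_le_iff₀ hκ] at hω2
    rw [div_le_iff₀ hω0]
    linarith
  have hC1' : C₁ / ω ≤ C / ω := by gcongr; linarith
  refine ⟨?_, ?_⟩
  · rw [div_le_iff₀ (by positivity)]
    linarith
  obtain ⟨θ, hθ, hfix⟩ := exists_eq_integral_modulatedKernel hκ hG hGe (ω := ω) fun θ hθ => by
    have := h₁ θ ω 0 hθ hω1 le_rfl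
    rw [mul_zero, Real.exp_zero, mul_one] at this
    linarith
  have h3 := h₂ θ ω hθ hω1
  have hΦ0 : ∫ s in Set.Ioi 0, modulatedKernel G ω 0 s = ∫ s in Set.Ioi 0, Real.cos (ω * s) * G s := by
    simp [modulatedKernel]
  rw [← hfix, hΦ0] at h3
  set Φ₀ := ∫ s in Set.Ioi 0, Real.cos (ω * s) * G s with hΦdef
  -- From |θ - Φ₀| ≤ |θ| C₂/ω one gets θ (1 - e₁) = Φ₀; when θ = 0 this forces Φ₀ = 0. Inverting 1 -
  -- e₁ ≥ 1/2 at most doubles the error, hence 2 C₂ in `C`.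
  obtain ⟨e₁, he₁, hθe⟩ : ∃ e₁, |e₁| ≤ C₂ / ω ∧ θ - Φ₀ = θ * e₁ := by
    rcases eq_or_ne θ 0 with h0 | hne
    · refine ⟨0, by rw [abs_zero]; positivity, ?_⟩
      rw [h0, abs_zero, zero_mul] at h3
      rw [mul_zero, h0]
      exact abs_eq_zero.1 (le_antisymm h3 (abs_nonneg _))
    · refine ⟨(θ - Φ₀) / θ, ?_, by field_simp⟩
      rw [abs_div, div_le_iff₀ (abs_pos.2 hne)]
      linarith
  have he₁' : |e₁| ≤ 1 / 2 := by
    refine he₁.trans ?_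
    rw [div_le_iff₀ hω0]
    linarith
  have hpos : 1 / 2 ≤ 1 - e₁ := by linarith [(abs_le.1 he₁').2]
  have hne : 1 - e₁ ≠ 0 := by linarith
  refine ⟨θ, e₁ / (1 - e₁), hθ, ?_, hfix, ?_, fun t ht => ?_⟩
  · rw [abs_div, abs_of_pos (by linarith : 0 < 1 - e₁), div_le_iff₀ (by linarith)]
    have h4 : C / ω = C₁ / ω + 2 * (C₂ / ω) := by rw [hCdef]; ring
    have h5 : 0 ≤ C₁ / ω := by positivity
    nlinarith [abs_nonneg e₁]
  · have : 1 + e₁ / (1 - e₁) = 1 / (1 - e₁) := by field_simp; ring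
    rw [this, mul_one_div, eq_div_iff hne]
    linarith
  · refine (h₁ θ ω t hθ hω1 ht).trans ?_
    gcongr

end Rate

/-! ### Reduction of the system to a Volterra equation -/

section Reduction

variable {C ρ : ℝ} {q : ℝ → ℝ}

lemma Localized.memLp_two (hρ : 0 < ρ) (hq : Localized C ρ q) (t : ℝ) :
    MemLp (fun x => (q (x - t) : ℂ)) 2 volume := by
  have h1 : MemLp (fun x => q (x - t)) 2 volume := by
    refine (memLp_two_iff_integrable_sq (hq.meas_sub t)).2 ?_
    have h2 : Integrable fun x => q (x - t) := (hq.integrable hρ).comp_sub_right t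
    have h3 := h2.mul_bdd (c := C) (hq.meas_sub t) (by
      filter_upwards [hq.bound_sub t] with x hx
      refine hx.trans (mul_le_of_le_one_right hq.nonneg ?_)
      exact Real.exp_le_one_iff.2 (by nlinarith [abs_nonneg (x - t)]))
    simpa only [sq] using h3
  exact h1.ofReal

/-- The translate `x ↦ q(x - t)` as an element of `L²(ℝ; ℂ)`. -/
noncomputable def Localized.translate (hρ : 0 < ρ) (hq : Localized C ρ q) (t : ℝ) : L2RC :=
  (hq.memLp_two hρ t).toLp _

lemma Localized.coeFn_translate (hρ : 0 < ρ) (hq : Localized C ρ q) (t : ℝ) :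
    (hq.translate hρ t : ℝ → ℂ) =ᵐ[volume] fun x => (q (x - t) : ℂ) :=
  (hq.memLp_two hρ t).coeFn_toLp

lemma Localized.inner_translate (hρ : 0 < ρ) (hq : Localized C ρ q) (t : ℝ) (ψ : L2RC) :
    inner ℂ (hq.translate hρ t) ψ = ∫ x : ℝ, ψ x * (q (x - t) : ℂ) := by
  rw [L2.inner_def]
  refine integral_congr_ae ?_
  filter_upwards [hq.coeFn_translate hρ t] with x hx
  rw [hx]
  simp [RCLike.inner_apply]

lemma Localized.integrable_mul_translate (hρ : 0 < ρ) (hq : Localized C ρ q) (t : ℝ) (ψ : L2RC) :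
    Integrable fun x : ℝ => ψ x * (q (x - t) : ℂ) :=
  (Lp.memLp ψ).integrable_mul (hq.memLp_two hρ t)

lemma Localized.re_inner_translate (hρ : 0 < ρ) (hq : Localized C ρ q) (t : ℝ) (ψ : L2RC) :
    (inner ℂ (hq.translate hρ t) ψ).re = corr (fun x => (ψ x).re) q t := by
  have := integral_re (hq.integrable_mul_translate hρ t ψ)
  simp only [RCLike.re_to_complex] at this
  rw [hq.inner_translate hρ, ← this, corr]
  simp

lemma Localized.im_inner_translate (hρ : 0 < ρ) (hq : Localized C ρ q) (t : ℝ) (ψ : L2RC) :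
    (inner ℂ (hq.translate hρ t) ψ).im = corr (fun x => (ψ x).im) q t := by
  have := integral_im (hq.integrable_mul_translate hρ t ψ)
  simp only [RCLike.im_to_complex] at this
  rw [hq.inner_translate hρ, ← this, corr]
  simp

lemma Localized.inner_translate_translate (hρ : 0 < ρ) (hq : Localized C ρ q) (τ t : ℝ) :
    inner ℂ (hq.translate hρ τ) (hq.translate hρ t) = (corr q q (τ - t) : ℂ) := by
  rw [hq.inner_translate hρ, corr, ← integral_complex_ofReal,
    ← integral_sub_right_eq_self (fun x => ((q x * q (x - (τ - t)) : ℝ) : ℂ)) t]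
  refine integral_congr_ae ?_
  filter_upwards [hq.coeFn_translate hρ t] with x hx
  rw [hx]
  push_cast
  ring_nf

/-- The forcing term produced by the initial field. -/
noncomputable def forcing (q : ℝ → ℝ) (ω : ℝ) (ψ₀ : ℝ → ℂ) (t : ℝ) : ℝ :=
  -(1 / ω) * (Real.cos (ω * t) * corr (fun x => (ψ₀ x).re) q t
    - Real.sin (ω * t) * corr (fun x => (ψ₀ x).im) q t)

/-- Duhamel against a fixed vector: for fixed τ the scalar m(t) = ⟨q(· - τ), ψ(t)⟩ solves a linear
ODE, integrated from 0 to τ with the factor exp(iω(τ - t)). The real part of m(τ) is the integral in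
the amplitude equation, and the two powers of ω cancel in the kernel. -/
lemma IsSolution.hasDerivAt_amplitude {ω a₀ : ℝ} {ψ₀ : L2RC} {ψ : ℝ → L2RC} {a : ℝ → ℝ}
    (hρ : 0 < ρ) (hq : Localized C ρ q) (hω : ω ≠ 0) (hs : IsSolution q ω ψ₀ a₀ ψ a) (τ : ℝ) :
    HasDerivAt a (forcing q ω ψ₀ τ
      - ∫ s in (0 : ℝ)..τ, (Real.cos (ω * (τ - s)) * corr q q (τ - s)) * a s) τ := by
  have hG : Continuous (corr q q) := continuous_corr hρ hq.nonneg hq.meas hq.bound hq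
  have ha : Continuous a := hs.contDiff_amplitude.continuous
  have hψd : ∀ t, deriv ψ t
      = (Complex.I * (ω : ℂ)) • ψ t + ((ω : ℂ) * (a t : ℂ)) • hq.translate hρ t := by
    intro t
    refine Lp.ext ?_
    filter_upwards [hs.field_eq t, hq.coeFn_translate hρ t,
      Lp.coeFn_add ((Complex.I * (ω : ℂ)) • ψ t) (((ω : ℂ) * (a t : ℂ)) • hq.translate hρ t),
      Lp.coeFn_smul (Complex.I * (ω : ℂ)) (ψ t),
      Lp.coeFn_smul ((ω : ℂ) * (a t : ℂ)) (hq.translate hρ t)] with x h1 h2 h3 h4 h5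
    rw [h1, h3, Pi.add_apply, h4, h5, Pi.smul_apply, Pi.smul_apply, h2, smul_eq_mul, smul_eq_mul]
  set m : ℝ → ℂ := fun t => inner ℂ (hq.translate hρ τ) (ψ t) with hm
  have hmd : ∀ t, HasDerivAt m (Complex.I * ω * m t + ω * a t * (corr q q (τ - t) : ℂ)) t := by
    intro t
    have h1 : HasDerivAt ψ (deriv ψ t) t :=
      (hs.contDiff_field.differentiable (by simp)).differentiableAt.hasDerivAt
    have h2 := (hasDerivAt_const t (hq.translate hρ τ)).inner ℂ h1
    refine h2.congr_deriv ?_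
    rw [hψd t, inner_zero_left, add_zero, inner_add_right, inner_smul_right, inner_smul_right,
      hq.inner_translate_translate hρ]
  have hyd : ∀ t ∈ Set.uIcc 0 τ, HasDerivAt
      (fun t : ℝ => Complex.exp (Complex.I * ω * ((τ : ℂ) - t)) * m t)
      (Complex.exp (Complex.I * ω * ((τ : ℂ) - t)) * (ω * a t * (corr q q (τ - t) : ℂ))) t := by
    intro t _
    have h1 : HasDerivAt (fun t : ℝ => Complex.I * ω * ((τ : ℂ) - t)) (Complex.I * ω * (0 - 1)) t :=
      ((hasDerivAt_const t (τ : ℂ)).sub Complex.ofRealCLM.hasDerivAt).const_mul _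
    refine (h1.cexp.mul (hmd t)).congr_deriv ?_
    ring
  have hcont : Continuous fun t : ℝ =>
      Complex.exp (Complex.I * ω * ((τ : ℂ) - t)) * (ω * a t * (corr q q (τ - t) : ℂ)) := by
    fun_prop
  have hftc := intervalIntegral.integral_eq_sub_of_hasDerivAt hyd (hcont.intervalIntegrable _ _)
  have hexp : ∀ r : ℝ, Complex.exp (Complex.I * ω * r)
      = (Real.cos (ω * r) : ℂ) + (Real.sin (ω * r) : ℂ) * Complex.I := fun r => by
    have : Complex.I * ω * r = ((ω * r : ℝ) : ℂ) * Complex.I := by push_cast; ring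
    rw [this, Complex.exp_mul_I, ← Complex.ofReal_cos, ← Complex.ofReal_sin]
  have hre : ∫ s in (0 : ℝ)..τ, ω * ((Real.cos (ω * (τ - s)) * corr q q (τ - s)) * a s)
      = (∫ s in (0 : ℝ)..τ, Complex.exp (Complex.I * ω * ((τ : ℂ) - s))
          * (ω * a s * (corr q q (τ - s) : ℂ))).re := by
    have := Complex.reCLM.intervalIntegral_comp_comm (hcont.intervalIntegrable (μ := volume) 0 τ)
    simp only [Complex.reCLM_apply] at this
    rw [← this]
    congr 1
    ext s
    rw [← Complex.ofReal_sub, hexp, ← Complex.ofReal_mul, ← Complex.ofReal_mul,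
      Complex.re_mul_ofReal, Complex.add_re, Complex.re_ofReal_mul, Complex.I_re,
      Complex.ofReal_re]
    ring
  rw [hftc, intervalIntegral.integral_const_mul, sub_self, mul_zero, Complex.exp_zero, one_mul,
    Complex.ofReal_zero, sub_zero, hexp, Complex.sub_re, Complex.mul_re] at hre
  have hm0 : m 0 = inner ℂ (hq.translate hρ τ) ψ₀ := by rw [hm]; simp only [hs.field_init]
  have hmτ : (m τ).re = corr (fun x => (ψ τ x).re) q τ := hq.re_inner_translate hρ τ (ψ τ)
  rw [hmτ, hm0, hq.re_inner_translate hρ, hq.im_inner_translate hρ] at hre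
  have hda := (hs.contDiff_amplitude.differentiable (by simp) τ).hasDerivAt
  refine hda.congr_deriv ?_
  rw [hs.amplitude_eq τ]
  change -(1 / ω) * corr (fun x => (ψ τ x).re) q τ = _
  simp only [Complex.add_re, Complex.add_im, Complex.re_ofReal_mul, Complex.im_ofReal_mul,
    Complex.I_re, Complex.I_im, Complex.ofReal_re, Complex.ofReal_im, mul_zero, mul_one, add_zero,
    zero_add] at hre
  rw [forcing]
  have h6 : corr (fun x => (ψ τ x).re) q τ
      = (∫ s in (0 : ℝ)..τ, (Real.cos (ω * (τ - s)) * corr q q (τ - s)) * a s) * ω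
        + (Real.cos (ω * τ) * corr (fun x => (ψ₀ x).re) q τ
          - Real.sin (ω * τ) * corr (fun x => (ψ₀ x).im) q τ) := by
    linarith
  rw [h6]
  field_simp
  ring

end Reduction

/-! ### Long-time asymptotics of the amplitude -/

lemma forcing_zero (q : ℝ → ℝ) (ω t : ℝ) : forcing q ω (0 : L2RC) t = 0 := by
  simp [forcing, corr]

section Asymptotics

variable {C D ρ σ : ℝ} {q : ℝ → ℝ} {ψ₀ : L2RC}

lemma continuous_forcing (hρ : 0 < ρ) (hq : Localized C ρ q) (hD : 0 ≤ D)
    (hψ : ∀ᵐ x : ℝ, ‖ψ₀ x‖ ≤ D * Real.exp (-ρ * |x|)) (ω : ℝ) :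
    Continuous (forcing q ω ψ₀) := by
  have hm := (Lp.memLp ψ₀).1
  have h1 : Continuous (corr (fun x => (ψ₀ x).re) q) :=
    continuous_corr hρ hD hm.re
      (hψ.mono fun x hx => (Complex.abs_re_le_norm _).trans hx) hq
  have h2 : Continuous (corr (fun x => (ψ₀ x).im) q) :=
    continuous_corr hρ hD hm.im
      (hψ.mono fun x hx => (Complex.abs_im_le_norm _).trans hx) hq
  unfold forcing
  fun_prop

lemma exists_abs_forcing_le (hσ : 0 ≤ σ) (hσρ : σ < ρ) (hq : Localized C ρ q) (hD : 0 ≤ D)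
    (hψ : ∀ᵐ x : ℝ, ‖ψ₀ x‖ ≤ D * Real.exp (-ρ * |x|)) (ω : ℝ) :
    ∃ M : ℝ, 0 ≤ M ∧ ∀ t, 0 ≤ t → |forcing q ω ψ₀ t| ≤ M * Real.exp (-σ * t) := by
  set M₀ := D * C * (∫ x : ℝ, Real.exp (-(ρ - σ) * |x|)) with hM₀
  have hM₀0 : 0 ≤ M₀ := mul_nonneg (mul_nonneg hD hq.nonneg)
    (integral_nonneg fun x => (Real.exp_pos _).le)
  refine ⟨|1 / ω| * (M₀ + M₀), by positivity, fun t ht => ?_⟩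
  have h1 := abs_corr_le (u := fun x => (ψ₀ x).re) hσ hσρ hD
    (hψ.mono fun x hx => (Complex.abs_re_le_norm _).trans hx) hq t
  have h2 := abs_corr_le (u := fun x => (ψ₀ x).im) hσ hσρ hD
    (hψ.mono fun x hx => (Complex.abs_im_le_norm _).trans hx) hq t
  rw [abs_of_nonneg ht, ← hM₀] at h1 h2
  have hc := Real.abs_cos_le_one (ω * t)
  have hs := Real.abs_sin_le_one (ω * t)
  rw [forcing, abs_mul, abs_neg, mul_assoc]
  gcongr
  refine (abs_sub _ _).trans ?_
  rw [abs_mul, abs_mul, add_mul]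
  refine add_le_add ?_ ?_
  · exact (mul_le_of_le_one_left (abs_nonneg _) hc).trans h1
  · exact (mul_le_of_le_one_left (abs_nonneg _) hs).trans h2

/-- Both claims follow from one explicit limit, linear in the data. The rate and prefactor are fixed
before the initial data, as their independence of it requires. -/
lemma exists_rate_prefactor (hρ : 0 < ρ) (hq : Localized C ρ q) :
    ∃ C' ω₀ : ℝ, 0 ≤ C' ∧ 0 < ω₀ ∧ ∀ ω, ω₀ ≤ ω → ∃ θ e d : ℝ,
      |e| ≤ C' / ω ∧ |d| ≤ C' / ω ∧
      θ = 2 * Real.pi ^ 2 * ‖fourierHat q ω‖ ^ 2 * (1 + e) ∧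
      ∀ (ψ₀ : L2RC) (D : ℝ), 0 ≤ D → (∀ᵐ x : ℝ, ‖ψ₀ x‖ ≤ D * Real.exp (-ρ * |x|)) →
        ∀ (a₀ : ℝ) (ψ : ℝ → L2RC) (a : ℝ → ℝ), IsSolution q ω ψ₀ a₀ ψ a → ∃ b : ℝ → ℝ,
          (∀ t, a t = (a₀ + ∫ s in Set.Ioi 0, Real.exp (θ * s) * forcing q ω ψ₀ s) * (1 + d)
            * Real.exp (-(θ * t)) + b t) ∧ DecaysBelowHalf ρ b := by
  -- Budget in units of κ: G and the forcing decay at 15; exp(θs) costs 1, leaving 14; the Volterra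
  -- estimate runs at 12, with gap 2; undoing exp(θt) costs 1. The remaining 11 exceeds 8κ = ρ/2.
  set κ := ρ / 16 with hκdef
  have hκ : 0 < κ := by positivity
  have hσ : 0 ≤ 15 * κ := by positivity
  have hσρ : 15 * κ < ρ := by rw [hκdef]; linarith
  set G := corr q q with hGdef
  have hG : Continuous G := continuous_corr hρ hq.nonneg hq.meas hq.bound hq
  have hGe := expLip_corr hσ hσρ hq.nonneg hq.meas hq.bound hq
  obtain ⟨C₁, ω₀, hC₁, hω₀, hrate⟩ := exists_decayRate hκ hG hGe
  have hω₀' : 0 < ω₀ := Real.pi_pos.trans_le hω₀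
  refine ⟨C₁ + 2 * (C₁ / (14 * κ)), ω₀, by positivity, hω₀', fun ω hω => ?_⟩
  have hω0 : 0 < ω := hω₀'.trans_le hω
  obtain ⟨hsmall, θ, e, hθ, he, hfix, hθe, htail⟩ := hrate ω hω
  set N : ℝ → ℝ := fun t => θ - ∫ s in (0 : ℝ)..t, modulatedKernel G ω θ s with hN
  have hkc : Continuous (modulatedKernel G ω θ) := continuous_modulatedKernel hG ω θ
  have hNc : Continuous N := continuous_const.sub
    (intervalIntegral.continuous_primitive (fun _ _ => hkc.intervalIntegrable _ _) 0)
  have hki : IntegrableOn (modulatedKernel G ω θ) (Set.Ioi 0) :=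
    integrableOn_Ioi_of_abs_le (lam := 14 * κ) (by linarith) hkc
      fun s hs => abs_modulatedKernel_le hGe hθ ω hs.le
  have hNb : ∀ t, 0 ≤ t → |N t| ≤ C₁ / ω * Real.exp (-(14 * κ) * t) := by
    intro t ht
    -- This is where the fixed-point equation enters: θ is the full integral of the kernel, so `N`
    -- is its tail.
    have h1 : N t = ∫ s in Set.Ioi t, modulatedKernel G ω θ s := by
      have := intervalIntegral.integral_Ioi_sub_Ioi hki ht
      rw [← hfix] at this
      simp only [hN]
      linarith
    rw [h1]
    exact htail t ht
  set n := ∫ s in Set.Ioi 0, N s with hn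
  have hnb : |n| ≤ C₁ / ω / (14 * κ) := by
    have := abs_integral_Ioi_le (t := 0) (by positivity : 0 < 14 * κ) fun s hs => hNb s hs.le
    simpa using this
  have hnh : |n| ≤ 1 / 2 := by
    refine (hnb.trans ?_).trans hsmall
    gcongr
    linarith
  have hn1 : 1 / 2 ≤ 1 - n := by linarith [(abs_le.1 hnh).2]
  have hne : 1 - n ≠ 0 := by linarith
  have hd1 : 1 + n / (1 - n) = 1 / (1 - n) := by field_simp; ring
  refine ⟨θ, e, n / (1 - n), ?_, ?_, ?_, ?_⟩
  · refine he.trans ?_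
    gcongr
    linarith [show 0 ≤ 2 * (C₁ / (14 * κ)) by positivity]
  · rw [abs_div, abs_of_pos (by linarith : 0 < 1 - n), div_le_iff₀ (by linarith)]
    have h4 : (C₁ + 2 * (C₁ / (14 * κ))) / ω = C₁ / ω + 2 * (C₁ / ω / (14 * κ)) := by
      field_simp
    have h5 : 0 ≤ C₁ / ω := by positivity
    nlinarith [abs_nonneg n]
  · rw [← integral_Ioi_cos_mul_corr (hq.integrable hρ)]
    exact hθe
  intro ψ₀ D hD hψ a₀ ψ a hs
  have hf : Continuous (forcing q ω ψ₀) := continuous_forcing hρ hq hD hψ ω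
  obtain ⟨M, hM, hfb⟩ := exists_abs_forcing_le hσ hσρ hq hD hψ ω
  have ha : Continuous a := hs.contDiff_amplitude.continuous
  set α := (a₀ + ∫ s in Set.Ioi 0, Real.exp (θ * s) * forcing q ω ψ₀ s) * (1 + n / (1 - n))
    with hα
  have hθ' : θ ≤ κ := (le_abs_self _).trans hθ
  have hθ'' : -θ ≤ κ := (neg_le_abs _).trans hθ
  obtain ⟨M', hM'⟩ := volterra_asymptotics (A := fun t => Real.exp (θ * t) * a t)
    (φ := fun t => Real.exp (θ * t) * forcing q ω ψ₀ t) (N := N) (a₀ := a₀) (D := M)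
    (ε := C₁ / ω) (lam := 14 * κ) (μ := 12 * κ) (α := α) (by fun_prop) (by fun_prop) hNc
    (fun t ht => by
      rw [abs_mul, abs_of_pos (Real.exp_pos _)]
      calc _ ≤ Real.exp (κ * t) * (M * Real.exp (-(15 * κ) * t)) := by
            have := hfb t ht
            gcongr
        _ = M * (Real.exp (κ * t) * Real.exp (-(15 * κ) * t)) := by ring
        _ = _ := by rw [← Real.exp_add]; ring_nf)
    hNb (by positivity) (by linarith)
    (by rwa [show 14 * κ - 12 * κ = 2 * κ by ring])
    (by rw [hα, hd1, ← hn]; field_simp)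
    (fun t ht => by
      have := volterra_integrated (K := fun s => Real.cos (ω * s) * G s) (N := N) (θ := θ) hf
        (by fun_prop) ha (fun t _ => hs.hasDerivAt_amplitude hρ hq hω0.ne' t) (fun t _ => rfl) ht
      rwa [hs.amplitude_init] at this)
  refine ⟨fun t => a t - α * Real.exp (-(θ * t)), fun t => by ring, fun ρ' hρ' =>
    ⟨M', fun t ht => ?_⟩⟩
  have e1 : a t - α * Real.exp (-(θ * t))
      = Real.exp (-(θ * t)) * (Real.exp (θ * t) * a t - α) := by
    rw [mul_sub, ← mul_assoc, ← Real.exp_add]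
    simp [mul_comm]
  have hM'0 : 0 ≤ M' := by simpa using (abs_nonneg _).trans (hM' 0 le_rfl)
  have hρ8 : ρ' < 8 * κ := by rw [hκdef]; linarith
  simp only [e1]
  rw [abs_mul, abs_of_pos (Real.exp_pos _)]
  calc _ ≤ Real.exp (ρ' * t) * (Real.exp (-(θ * t)) * (M' * Real.exp (-(12 * κ) * t))) := by
        have := hM' t ht
        gcongr
    _ = M' * Real.exp (ρ' * t + (-(θ * t) + -(12 * κ) * t)) := by
        rw [Real.exp_add, Real.exp_add]; ring
    _ ≤ M' * 1 := by
        gcongr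
        refine Real.exp_le_one_iff.2 ?_
        have : (ρ' - θ - 12 * κ) * t ≤ 0 := mul_nonpos_of_nonpos_of_nonneg (by linarith) ht
        linarith
    _ = M' := mul_one _

end Asymptotics

lemma exists_norm_le_of_memLp_top {ρ : ℝ} {ψ₀ : L2RC}
    (h : MemLp (fun x : ℝ => (Real.exp (ρ * |x|) : ℂ) * ψ₀ x) ∞ (volume : Measure ℝ)) :
    ∃ D : ℝ, 0 ≤ D ∧ ∀ᵐ x : ℝ, ‖ψ₀ x‖ ≤ D * Real.exp (-ρ * |x|) := by
  obtain ⟨D, hD, hb⟩ := exists_ae_norm_le h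
  refine ⟨D, hD, ?_⟩
  filter_upwards [hb] with x hx
  rw [norm_mul, Complex.norm_real, Real.norm_of_nonneg (Real.exp_pos _).le] at hx
  rw [neg_mul, Real.exp_neg, ← div_eq_mul_inv, le_div_iff₀ (Real.exp_pos _), mul_comm]
  exact hx

lemma isBigO_one_div_of_abs_le {f : ℝ → ℝ} {C ω₀ : ℝ} (hω₀ : 0 < ω₀)
    (h : ∀ ω, ω₀ ≤ ω → |f ω| ≤ C / ω) :
    Asymptotics.IsBigO atTop f (fun ω : ℝ => 1 / ω) := by
  refine Asymptotics.IsBigO.of_bound C ?_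
  filter_upwards [eventually_ge_atTop ω₀] with ω hω
  rw [Real.norm_eq_abs, Real.norm_of_nonneg (by have := hω₀.trans_le hω; positivity), mul_one_div]
  exact h ω hω

theorem theorem3p2 (q : ℝ → ℝ) (ρ : ℝ) (hρ : 0 < ρ)
    (hq : MemW1Infty (fun x : ℝ => Real.exp (ρ * |x|) * q x)) :
    ∃ θ r ε δ : ℝ → ℝ,
      Asymptotics.IsBigO atTop ε (fun ω : ℝ => 1 / ω) ∧
      Asymptotics.IsBigO atTop δ (fun ω : ℝ => 1 / ω) ∧
      ∀ᶠ ω : ℝ in atTop,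
        θ ω = 2 * Real.pi ^ 2 * ‖fourierHat q ω‖ ^ 2 * (1 + ε ω) ∧
        r ω = 1 + δ ω ∧
        (∀ (a₀ : ℝ) (ψ : ℝ → L2RC) (a : ℝ → ℝ), IsSolution q ω 0 a₀ ψ a →
          ∃ b : ℝ → ℝ,
            (∀ t : ℝ, a t = a₀ * r ω * Real.exp (-(θ ω * t)) + b t) ∧
            DecaysBelowHalf ρ b) ∧
        (∀ (ψ₀ : L2RC),
          MemLp (fun x : ℝ => (Real.exp (ρ * |x|) : ℂ) * ψ₀ x) ∞ (volume : Measure ℝ) →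
          ∀ a₀ : ℝ, ∃ α : ℝ,
            ∀ (ψ : ℝ → L2RC) (a : ℝ → ℝ), IsSolution q ω ψ₀ a₀ ψ a →
              ∃ b : ℝ → ℝ,
                (∀ t : ℝ, a t = α * Real.exp (-(θ ω * t)) + b t) ∧
                DecaysBelowHalf ρ b) := by
  obtain ⟨C, -, hloc⟩ := exists_localized hρ hq
  obtain ⟨C', ω₀, -, hω₀, h⟩ := exists_rate_prefactor hρ hloc
  choose! θ e d he hd hθ hsol using h
  refine ⟨θ, fun ω => 1 + d ω, e, d, isBigO_one_div_of_abs_le hω₀ he,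
    isBigO_one_div_of_abs_le hω₀ hd, ?_⟩
  filter_upwards [eventually_ge_atTop ω₀] with ω hω
  refine ⟨hθ ω hω, rfl, fun a₀ ψ a hs => ?_, fun ψ₀ hψ₀ a₀ => ?_⟩
  -- A zero field satisfies the localization bound with D = 0 and produces no forcing, so the limit
  -- reduces to a₀ (1 + d).
  · obtain ⟨b, hb, hdec⟩ := hsol ω hω 0 0 le_rfl (by simp) a₀ ψ a hs
    refine ⟨b, fun t => ?_, hdec⟩
    simpa only [forcing_zero, mul_zero, integral_zero, add_zero] using hb t
  · obtain ⟨D, hD, hDb⟩ := exists_norm_le_of_memLp_top hψ₀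
    exact ⟨_, fun ψ a hs => hsol ω hω ψ₀ D hD hDb a₀ ψ a hs⟩
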